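/- Let $k$ be an algebraically closed field. For a power series $f\in k[[x]]$ algebraic over $k[x]$, let $P(x,T)\in k[x,T]$ be its minimal polynomial, i.e. a generator (unique up to a nonzero constant) of the ideal $\{Q\in k[x,T]: Q(x,f)=0\}$; the degree of $f$ is $\deg_T P$ and its height is $\deg_x P$. For $d,h,e\in\mathbb N$ let $\mathcal A(d,h)_0$ be the set of algebraic power series of degree $\le d$ and height $\le h$ vanishing at $0$; let $\mathcal I(d,h)$ be the set of $f\in\mathcal A(d,h)_0$ with $P(0,0)=0$ and $\frac{\partial P}{\partial T}(0,0)\ne 0$; and let $\mathcal A(d,h,e)$ be the set of $f\in\mathcal A(d,h)_0$ with $\operatorname{ord}\frac{\partial P}{\partial T}(x,f)=e$. Let $\psi_{d,h}$ send $f\in\mathcal I(d,h)$ to the vector of the coefficients of $x^iT^j$ ($i\le h$, $j\le d$, $(i,j)\ne(0,0),(0,1)$) of its minimal polynomial, normalized so that the coefficient of $x^0T^1$ is $1$; its target is an affine space, of dimension $dh+d+h-1$ if $d\ge1$. Put $\mathcal C_{d,h}=\psi_{d,h}(\mathcal I(d,h))$. Write $h_e=h+e(d-2)$, where here and below $d-2$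 is read as $0$ if $d\le 1$. Each power series $f$ vanishing at $0$ is uniquely $f=f^{(0)}+x^ef^{(1)}$ with $f^{(0)}$ a polynomial of degree $\le e$ vanishing at $0$ (a point of $\mathbb A_k^e$) and $f^{(1)}$ a power series vanishing at $0$. (i) Let $d,h,e\in\mathbb N$. If $f\in\mathcal A(d,h,e)$ then $f^{(1)}\in\mathcal I(d,h_e)$. The map $f\mapsto (f^{(0)},\psi_{d,h_e}(f^{(1)}))$ is injective on $\mathcal A(d,h,e)$, and its image $\mathcal C_{d,h,e}$ is contained in $\mathbb A_k^e\times\mathcal C_{d,h_e}$ and is a constructible subset of the ambient affine space. (ii) Let $d\ge 1$, $h\ge0$. Then $\mathcal A(d,h)_0=\bigcup_{e\le 2dh}\mathcal A(d,h,e)$. Put $$N(d,h)=2dh(d-2)(d+1)+3dh+d+h-1 .$$ There are injective affine maps $\iota_e$ ($e\le 2dh$), from $\mathbb A_k^e\times\mathbb A_k^{dh_e+d+h_e-1}$ to $\mathbb A_k^{N(d,h)}$, such that sending $f\in \mathcal A(d,h,e)$ to $\iota_e(f^{(0)},\psi_{d,h_e}(f^{(1)}))$ for every $e\le 2dh$ defines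 a bijection from $\mathcal A(d,h)_0$ onto $\bigcup_{e\le 2dh}\iota_e(\mathcal C_{d,h,e})$. Moreover, for every $M$ and every choice of injective affine maps $\iota_e$ ($e\le 2dh$) into $\mathbb A_k^{M}$, the set $\bigcup_{e\le 2dh}\iota_e(\mathcal C_{d,h,e})$ is constructible in $\mathbb A_k^M$. (iii) If $d\ge1$ and $h\ge 1$, then for every $M$ and every choice of injective affine maps $\iota_e$ ($e\le 2dh$) into $\mathbb A_k^{M}$, the constructible set $\bigcup_{e\le 2dh}\iota_e(\mathcal C_{d,h,e})$ has dimension $dh+d+h-1$. -/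

import Mathlib

open Polynomial PowerSeries

noncomputable section

/-! Bivariate polynomials `P(x,T)` are elements of `k[X][X]`: the inner variable is `x`, the outer
one is `T`. Power series in `x` are elements of `k⟦X⟧`. -/

namespace AlgSeries

section Series

variable {k : Type*} [Field k]

/-- The ideal of all `P ∈ k[x,T]` with `P(x,f) = 0`. -/
def relationIdeal (f : k⟦X⟧) : Ideal k[X][X] :=
  RingHom.ker (Polynomial.aeval (R := k[X]) f)

/-- `P` is a minimal polynomial of `f`: a generator of the ideal of relations of `f`. -/
def IsMinimalPolynomial (f : k⟦X⟧) (P : k[X][X]) : Prop :=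
  relationIdeal f = Ideal.span {P}

open Classical in
/-- The minimal polynomial of `f` (well defined up to a nonzero constant of `k`). -/
def minPoly (f : k⟦X⟧) : k[X][X] :=
  if H : ∃ P, IsMinimalPolynomial f P then H.choose else 0

/-- The height of a polynomial in `T`: the maximum of the degrees in `x` of its coefficients. -/
def polyHeight (P : k[X][X]) : ℕ :=
  P.support.sup fun j => (P.coeff j).natDegree

/-- The degree of an algebraic power series. -/
def seriesDegree (f : k⟦X⟧) : ℕ := (minPoly f).natDegree

/-- The height of an algebraic power series. -/
def seriesHeight (f : k⟦X⟧) : ℕ := polyHeight (minPoly f)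

variable (k) in
/-- `𝒜(d,h)`: algebraic power series of degree at most `d` and height at most `h`. -/
def algSet (d h : ℕ) : Set k⟦X⟧ :=
  {f | IsAlgebraic k[X] f ∧ seriesDegree f ≤ d ∧ seriesHeight f ≤ h}

variable (k) in
/-- `𝒜(d,h)₀`: the elements of `𝒜(d,h)` that vanish at `0`. -/
def algSetZero (d h : ℕ) : Set k⟦X⟧ :=
  {f | f ∈ algSet k d h ∧ PowerSeries.constantCoeff f = 0}

variable (k) in
/-- `ℐ(d,h)`: the elements of `𝒜(d,h)₀` whose minimal polynomial `P` satisfies `P(0,0) = 0` and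
`(∂P/∂T)(0,0) ≠ 0`. -/
def implicitSet (d h : ℕ) : Set k⟦X⟧ :=
  {f | f ∈ algSetZero k d h ∧ ((minPoly f).eval 0).eval 0 = 0 ∧
    ((derivative (minPoly f)).eval 0).eval 0 ≠ 0}

variable (k) in
/-- `𝒜(d,h,e)`: the elements of `𝒜(d,h)₀` with `ord ((∂P/∂T)(x,f)) = e`. -/
def stratum (d h e : ℕ) : Set k⟦X⟧ :=
  {f | f ∈ algSetZero k d h ∧
    (Polynomial.aeval (R := k[X]) f (derivative (minPoly f))).order = (e : ℕ∞)}

/-- The coordinates in `𝔸^e` of the polynomial `f⁽⁰⁾` of degree `≤ e` vanishing at `0`, where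
`f = f⁽⁰⁾ + x^e f⁽¹⁾`: the coefficients of `x, …, x^e`. -/
def head (e : ℕ) (f : k⟦X⟧) : Fin e → k :=
  fun i => PowerSeries.coeff ((i : ℕ) + 1) f

/-- The series `f⁽¹⁾`, vanishing at `0`, where `f = f⁽⁰⁾ + x^e f⁽¹⁾`. -/
def tail (e : ℕ) (f : k⟦X⟧) : k⟦X⟧ :=
  PowerSeries.mk fun n => if n = 0 then 0 else PowerSeries.coeff (e + n) f

/-- The decomposition `f = f⁽⁰⁾ + x^e f⁽¹⁾` of a series vanishing at `0`. -/
theorem eq_head_add_tail (e : ℕ) (f : k⟦X⟧) (hf : PowerSeries.constantCoeff f = 0) :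
    f = (∑ i : Fin e, PowerSeries.C (head e f i) * PowerSeries.X ^ ((i : ℕ) + 1)) +
      PowerSeries.X ^ e * tail e f := by
  ext n
  have key : PowerSeries.coeff n
      (∑ i : Fin e, PowerSeries.C (head e f i) * (PowerSeries.X : k⟦X⟧) ^ ((i : ℕ) + 1)) =
      if 1 ≤ n ∧ n ≤ e then PowerSeries.coeff n f else 0 := by
    simp only [map_sum, PowerSeries.coeff_C_mul_X_pow, head]
    split_ifs with hn
    · rw [Finset.sum_eq_single (⟨n - 1, by omega⟩ : Fin e)]
      · have : n - 1 + 1 = n := by omega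
        simp [this]
      · intro b _ hb
        rw [if_neg]
        intro h
        apply hb
        ext
        simp only
        omega
      · simp
    · apply Finset.sum_eq_zero
      intro i _
      rw [if_neg]
      have := i.2
      omega
  rw [map_add, key, PowerSeries.coeff_X_pow_mul', tail]
  rcases Nat.eq_zero_or_pos n with rfl | hn
  · simp [hf]
  · by_cases h1 : n ≤ e
    · rw [if_pos ⟨hn, h1⟩]
      split_ifs with h2
      · have : n - e = 0 := by omega
        simp [this]
      · simp
    · have h3 : n - e ≠ 0 := by omega
      have h4 : e + (n - e) = n := by omega
      rw [if_neg (by omega), if_pos (by omega)]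
      simp [h3, h4]

/-- Index set of the affine space of the polynomials `∑ a_{ij} x^i T^j` (`i ≤ h`, `j ≤ d`) with
`a_{00} = 0` and `a_{01} = 1`: all pairs `(i,j)` except `(0,0)` and `(0,1)`. -/
abbrev CoeffIndex (d h : ℕ) : Type :=
  {p : Fin (h + 1) × Fin (d + 1) // (p.1 : ℕ) ≠ 0 ∨ 2 ≤ (p.2 : ℕ)}

/-- That affine space has dimension `dh + d + h - 1`. -/
theorem card_coeffIndex (d h : ℕ) (hd : 1 ≤ d) :
    Fintype.card (CoeffIndex d h) = d * h + d + h - 1 := by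
  have h1 := Fintype.card_subtype_compl
    (fun p : Fin (h + 1) × Fin (d + 1) => (p.1 : ℕ) ≠ 0 ∨ 2 ≤ (p.2 : ℕ))
  have h2 : Fintype.card {p : Fin (h + 1) × Fin (d + 1) //
      ¬ ((p.1 : ℕ) ≠ 0 ∨ 2 ≤ (p.2 : ℕ))} = 2 := by
    rw [Fintype.card_subtype]
    have : (Finset.univ.filter fun p : Fin (h + 1) × Fin (d + 1) =>
        ¬ ((p.1 : ℕ) ≠ 0 ∨ 2 ≤ (p.2 : ℕ))) =
        {((0 : Fin (h + 1)), (⟨0, by omega⟩ : Fin (d + 1))),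
          ((0 : Fin (h + 1)), (⟨1, by omega⟩ : Fin (d + 1)))} := by
      ext ⟨i, j⟩
      simp only [Finset.mem_filter, Finset.mem_univ, true_and, Finset.mem_insert,
        Finset.mem_singleton, Prod.mk.injEq, Fin.ext_iff, Fin.val_zero]
      omega
    rw [this, Finset.card_pair]
    simp [Fin.ext_iff]
  rw [h2, Fintype.card_prod, Fintype.card_fin, Fintype.card_fin] at h1
  have h3 : (h + 1) * (d + 1) = d * h + d + h + 1 := by ring
  have h5 : Fintype.card (CoeffIndex d h) ≤ (h + 1) * (d + 1) := by
    refine (Fintype.card_subtype_le _).trans (le_of_eq ?_)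
    simp
  have h6 : 2 = (h + 1) * (d + 1) - Fintype.card (CoeffIndex d h) := by
    rw [← h1]
  omega

/-- `ψ_{d,h}`: the vector of coefficients of the minimal polynomial, normalized so that the
coefficient of `x^0 T^1` is `1`. -/
def psi (d h : ℕ) (f : k⟦X⟧) : CoeffIndex d h → k :=
  fun p => ((minPoly f).coeff (p.1.2 : ℕ)).coeff (p.1.1 : ℕ) / ((minPoly f).coeff 1).coeff 0

variable (k) in
/-- `𝒞_{d,h} = ψ_{d,h}(ℐ(d,h))`. -/
def implicitImage (d h : ℕ) : Set (CoeffIndex d h → k) :=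
  psi d h '' implicitSet k d h

/-- Index set of the coordinates of `𝔸^e × 𝔸^{dh' + d + h' - 1}`, where `h' = h + e(d-2)`
(with `d - 2` read as `0` if `d ≤ 1`). -/
abbrev ChartIndex (d h e : ℕ) : Type :=
  Fin e ⊕ CoeffIndex d (h + e * (d - 2))

/-- The map `(Id × ψ_{d,h+e(d-2)}) ∘ φ_{d,h,e}`, `f ↦ (f⁽⁰⁾, ψ(f⁽¹⁾))`. -/
def chart (d h e : ℕ) (f : k⟦X⟧) : ChartIndex d h e → k :=
  Sum.elim (head e f) (psi d (h + e * (d - 2)) (tail e f))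

variable (k) in
/-- `𝒞_{d,h,e}`: the image of `𝒜(d,h,e)`. -/
def stratumImage (d h e : ℕ) : Set (ChartIndex d h e → k) :=
  chart d h e '' stratum k d h e

end Series

section AffineSpace

variable {k : Type*} [Field k] {σ : Type*}

/-- Constructible subsets of affine space: Boolean combinations of zero loci of polynomials. -/
def IsConstructibleSet (S : Set (σ → k)) : Prop :=
  S ∈ BooleanSubalgebra.closure
    {Z : Set (σ → k) | ∃ I : Ideal (MvPolynomial σ k), Z = MvPolynomial.zeroLocus k I}

/-- The dimension of a subset of affine space: the Krull dimension of the coordinate ring of its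
Zariski closure. -/
def zariskiDim (S : Set (σ → k)) : WithBot ℕ∞ :=
  ringKrullDim (MvPolynomial σ k ⧸ MvPolynomial.vanishingIdeal k S)

end AffineSpace

/-- `N(d,h) = 2dh(d-2)(d+1) + 3dh + d + h - 1` (with `d - 2` read as `0` if `d ≤ 1`). -/
def ambientDim (d h : ℕ) : ℕ :=
  2 * d * h * (d - 2) * (d + 1) + 3 * d * h + d + h - 1

/-- The union over `e ≤ 2dh` of the sets `𝒞_{d,h,e}`, put into one affine space by maps `ι e`. -/
def imageUnion {k : Type*} [Field k] (d h : ℕ) {M : ℕ}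
    (ι : (e : ℕ) → (ChartIndex d h e → k) →ᵃ[k] (Fin M → k)) : Set (Fin M → k) :=
  ⋃ e ∈ Set.Iic (2 * d * h), ι e '' stratumImage k d h e

end AlgSeries

end

/-!
Why the theorem is true.

*Minimal polynomials.* By Gauss's lemma an irreducible `P ∈ k[x,T]` that does not divide `R` has
nonzero resultant with it, so an irreducible relation of `f` generates the ideal of relations
(`isMinimalPolynomial_of_irreducible`). It is separable in every characteristic, because `k` is
perfect and `1, x, …, x^(p-1)` are independent over `k((x))^p` (`derivative_ne_zero_of_irreducible`),
and `(∂P/∂T)(x,f)` divides the resultant of `P` and `∂P/∂T`, which has degree at most `(2d-1)h` in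
`x` (`order_derivative_le`). This gives the stratification.

*Charts.* Write `f = a + x^e g`, with `a` the head of `f` and `g` its tail. If `∂P/∂T(x,f)` has
order `e`, Taylor's formula shows that `P(x, a + x^e T) = x^(2e) Q` with `Q(0,0) = 0` and
`∂Q/∂T(0,0) ≠ 0`. Since the substitution is invertible away from `x = 0`, `Q` is again irreducible,
hence the minimal polynomial of `g`; its height is at most `h + e(d-2)`. The implicit function
theorem recovers `g` from `Q`. Conversely `(a, Q)` determines `P`, so the image of the stratum
consists of the `(a, Q)` for which `x^(2e) Q(x, (T - a)/x^e)` is an irreducible polynomial of degree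
at most `d` and height at most `h` (`mem_stratumImage_iff`).

*Constructibility.* Both `f` and `P` are polynomial functions of `(a, Q)`: the implicit function
theorem holds over the polynomial ring in the coordinates (`branch`, `map_branch`). As `P` has the
root `f`, it is irreducible iff the linear system `R(x,f) = 0` in the coefficients of `R`, where `R`
ranges over the smallest box of exponents containing `P`, has only the constant multiples of `P` as
solutions (`irreducible_iff_exists_rigidAt`). This is the nonvanishing of some maximal minor
(`isConstructibleSet_injective`), so no elimination theory is needed.

*Dimension.* For `e = 0` the image of the stratum contains a nonempty open subset of an affine space
of dimension `dh + d + h - 1`, because `T + x^h + x^h T^d` is irreducible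
(`exists_open_subset_stratumImage_zero`). For `e ≥ 1` the polynomial `P` has no terms `x^0 T^0` and
`x^0 T^1`, hence only `dh + d + h - 1` coefficients, and at every point of the closure with values
in a domain the coordinates are algebraic over these coefficients, because the coefficients of a
power series root of `P` are (`coeff_mem_range_of_aeval_eq_zero`, `isAlgebraic_coordinates`). By
Noether normalization the Krull dimension is bounded by their number.
-/

noncomputable section

namespace AlgSeries

/-! ### The height of a bivariate polynomial -/

section Height

variable {R : Type*} [CommRing R]

theorem coeff_coeff_swap (P : R[X][X]) (i j : ℕ) :
    ((Bivariate.swap P).coeff i).coeff j = (P.coeff j).coeff i := by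
  induction P using Polynomial.induction_on' with
  | add p q hp hq => simp [map_add, hp, hq]
  | monomial n p =>
    induction p using Polynomial.induction_on' with
    | add p q hp hq => simp only [map_add, Polynomial.coeff_add, hp, hq]
    | monomial m r =>
      rw [Bivariate.swap_monomial_monomial]
      simp only [Polynomial.coeff_monomial]
      split_ifs <;> simp_all [Polynomial.coeff_monomial]

theorem polyHeight_le_iff {k : Type*} [Field k] {P : k[X][X]} {h : ℕ} :
    polyHeight P ≤ h ↔ ∀ j, (P.coeff j).natDegree ≤ h := by
  rw [polyHeight, Finset.sup_le_iff]
  refine ⟨fun H j => ?_, fun H j _ => H j⟩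
  by_cases hj : P.coeff j = 0
  · simp [hj]
  · exact H j (Polynomial.mem_support_iff.2 hj)

/-- The height is the degree in the inner variable, so that it behaves like a degree. -/
theorem polyHeight_eq_natDegree_swap {k : Type*} [Field k] (P : k[X][X]) :
    polyHeight P = (Bivariate.swap P).natDegree := by
  apply le_antisymm
  · rw [polyHeight_le_iff]
    intro j
    rw [Polynomial.natDegree_le_iff_coeff_eq_zero]
    intro i hi
    rw [← coeff_coeff_swap, Polynomial.coeff_eq_zero_of_natDegree_lt hi, Polynomial.coeff_zero]
  · rw [Polynomial.natDegree_le_iff_coeff_eq_zero]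
    intro i hi
    ext j
    rw [coeff_coeff_swap, Polynomial.coeff_zero]
    exact Polynomial.coeff_eq_zero_of_natDegree_lt ((polyHeight_le_iff.1 le_rfl j).trans_lt hi)

variable {k : Type*} [Field k]

theorem polyHeight_le_iff_coeff {P : k[X][X]} {h : ℕ} :
    polyHeight P ≤ h ↔ ∀ i j, h < i → (P.coeff j).coeff i = 0 := by
  rw [polyHeight_le_iff]
  exact ⟨fun H i j hi => Polynomial.coeff_eq_zero_of_natDegree_lt ((H j).trans_lt hi),
    fun H j => Polynomial.natDegree_le_iff_coeff_eq_zero.2 fun i hi => H i j hi⟩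

theorem polyHeight_mul {P Q : k[X][X]} (hP : P ≠ 0) (hQ : Q ≠ 0) :
    polyHeight (P * Q) = polyHeight P + polyHeight Q := by
  simp only [polyHeight_eq_natDegree_swap, map_mul]
  exact Polynomial.natDegree_mul (by simpa using hP) (by simpa using hQ)

theorem polyHeight_C (p : k[X]) : polyHeight (Polynomial.C p) = p.natDegree := by
  rw [polyHeight_eq_natDegree_swap, Bivariate.swap_C,
    Polynomial.natDegree_map_eq_of_injective Polynomial.C_injective]

theorem eq_C_C_of_natDegree_of_polyHeight {P : k[X][X]} (h1 : P.natDegree = 0)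
    (h2 : polyHeight P = 0) : ∃ u : k, P = Polynomial.C (Polynomial.C u) := by
  obtain ⟨p, rfl⟩ := Polynomial.natDegree_eq_zero.1 h1
  rw [polyHeight_C] at h2
  obtain ⟨u, rfl⟩ := Polynomial.natDegree_eq_zero.1 h2
  exact ⟨u, rfl⟩

theorem natDegree_C_C_mul {u : k} (hu : u ≠ 0) (P : k[X][X]) :
    (Polynomial.C (Polynomial.C u) * P).natDegree = P.natDegree :=
  Polynomial.natDegree_C_mul (by simpa using hu)

theorem polyHeight_C_C_mul {u : k} (hu : u ≠ 0) (P : k[X][X]) :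
    polyHeight (Polynomial.C (Polynomial.C u) * P) = polyHeight P := by
  by_cases hP : P = 0
  · simp [hP]
  rw [polyHeight_mul (by simpa using hu) hP, polyHeight_C, Polynomial.natDegree_C, zero_add]

end Height

/-! ### Evaluation at power series -/

section Eval

variable {A : Type*} [CommRing A]

theorem aeval_C_series (f : A⟦X⟧) (p : A[X]) :
    Polynomial.aeval (R := A[X]) f (Polynomial.C p) = (p : A⟦X⟧) := by
  rw [Polynomial.aeval_C]; rfl

/-- The constant term of `P(x, f)` is `P(0, f(0))`. -/
theorem constantCoeff_aeval (f : A⟦X⟧) (P : A[X][X]) :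
    PowerSeries.constantCoeff (Polynomial.aeval (R := A[X]) f P) =
      ((Bivariate.swap P).coeff 0).eval (PowerSeries.constantCoeff f) := by
  induction P using Polynomial.induction_on' with
  | add p q hp hq => simp [map_add, hp, hq]
  | monomial n p =>
    have h0 : (Bivariate.swap (Polynomial.monomial n p)).coeff 0 =
        Polynomial.monomial n (p.coeff 0) := by
      ext j
      rw [coeff_coeff_swap, Polynomial.coeff_monomial, Polynomial.coeff_monomial]
      split_ifs <;> simp
    rw [h0, ← Polynomial.C_mul_X_pow_eq_monomial, map_mul, aeval_C_series]
    simp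

theorem eval_eval_zero (P : A[X][X]) : (P.eval 0).eval 0 = (P.coeff 0).coeff 0 := by
  rw [← Polynomial.coeff_zero_eq_eval_zero, ← Polynomial.coeff_zero_eq_eval_zero]

theorem constantCoeff_aeval_of_constantCoeff_eq_zero {f : A⟦X⟧}
    (hf : PowerSeries.constantCoeff f = 0) (P : A[X][X]) :
    PowerSeries.constantCoeff (Polynomial.aeval (R := A[X]) f P) = (P.coeff 0).coeff 0 := by
  rw [constantCoeff_aeval, hf, ← Polynomial.coeff_zero_eq_eval_zero, coeff_coeff_swap]

theorem coeff_derivative_zero_zero (P : A[X][X]) :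
    ((derivative P).coeff 0).coeff 0 = (P.coeff 1).coeff 0 := by
  rw [Polynomial.coeff_derivative]; simp

theorem coe_X_pow (n : ℕ) : (((Polynomial.X : A[X]) ^ n : A[X]) : A⟦X⟧) = PowerSeries.X ^ n := by
  simp

end Eval

/-! ### Minimal polynomials -/

section Minimal

variable {k : Type*} [Field k]

theorem coe_ne_zero_of_ne_zero {p : k[X]} (hp : p ≠ 0) : (p : k⟦X⟧) ≠ 0 := by
  simpa using hp

theorem mem_relationIdeal {f : k⟦X⟧} {P : k[X][X]} :
    P ∈ relationIdeal f ↔ Polynomial.aeval (R := k[X]) f P = 0 := by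
  rw [relationIdeal, RingHom.mem_ker]

theorem natDegree_ne_zero_of_aeval_eq_zero {f : k⟦X⟧} {P : k[X][X]} (hP : P ≠ 0)
    (h : Polynomial.aeval (R := k[X]) f P = 0) : P.natDegree ≠ 0 := by
  intro h0
  obtain ⟨p, rfl⟩ := Polynomial.natDegree_eq_zero.1 h0
  rw [aeval_C_series] at h
  exact coe_ne_zero_of_ne_zero (by simpa using hP) h

/-- By Gauss's lemma, an irreducible polynomial of positive degree in `T` is coprime over `k(x)`
to the polynomials that it does not divide. -/
theorem resultant_ne_zero_of_irreducible {P R : k[X][X]} (hP : Irreducible P)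
    (h0 : P.natDegree ≠ 0) (hR : ¬ P ∣ R) : Polynomial.resultant P R ≠ 0 := by
  have hprim : P.IsPrimitive := hP.isPrimitive h0
  let K := FractionRing k[X]
  have hinj : Function.Injective (algebraMap k[X] K) := IsFractionRing.injective _ _
  have hirr : Irreducible (P.map (algebraMap k[X] K)) :=
    hprim.irreducible_iff_irreducible_map_fraction_map.1 hP
  intro hres
  have h1 : Polynomial.resultant (P.map (algebraMap k[X] K)) (R.map (algebraMap k[X] K)) = 0 := by
    rw [Polynomial.natDegree_map_eq_of_injective hinj, Polynomial.natDegree_map_eq_of_injective hinj,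
      Polynomial.resultant_map_map, hres, map_zero]
  rw [Polynomial.resultant_eq_zero_iff] at h1
  refine h1.2 (hirr.coprime_iff_not_dvd.2 fun h2 => hR ?_)
  exact hprim.dvd_of_fraction_map_dvd_fraction_map h2

/-- An irreducible relation of `f` generates the ideal of relations: for a relation `R` that it
does not divide, the resultant would be a nonzero element of `k[x]` vanishing in `k⟦x⟧`. -/
theorem isMinimalPolynomial_of_irreducible {f : k⟦X⟧} {P : k[X][X]} (hP : Irreducible P)
    (h : Polynomial.aeval (R := k[X]) f P = 0) : IsMinimalPolynomial f P := by
  apply le_antisymm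
  · intro R hR
    rw [mem_relationIdeal] at hR
    rw [Ideal.mem_span_singleton]
    by_contra hdvd
    have h0 := natDegree_ne_zero_of_aeval_eq_zero hP.ne_zero h
    obtain ⟨p, q, -, -, hpq⟩ := Polynomial.exists_mul_add_mul_eq_C_resultant P R le_rfl le_rfl
      (Or.inl h0)
    apply coe_ne_zero_of_ne_zero (resultant_ne_zero_of_irreducible hP h0 hdvd)
    rw [← aeval_C_series (A := k) f, ← hpq, map_add, map_mul, map_mul, h, hR, zero_mul, zero_mul,
      add_zero]
  · rw [Ideal.span_singleton_le_iff_mem, mem_relationIdeal, h]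

theorem exists_irreducible_relation {f : k⟦X⟧} (hf : IsAlgebraic k[X] f) :
    ∃ P : k[X][X], Irreducible P ∧ Polynomial.aeval (R := k[X]) f P = 0 := by
  have hprime : (relationIdeal f).IsPrime := RingHom.ker_isPrime _
  have hbot : relationIdeal f ≠ ⊥ := by
    obtain ⟨Q, hQ0, hQ⟩ := hf
    intro hb
    have : Q ∈ relationIdeal f := mem_relationIdeal.2 hQ
    rw [hb] at this
    exact hQ0 (by simpa using this)
  obtain ⟨P, hPmem, hP⟩ := hprime.exists_mem_prime_of_ne_bot hbot
  exact ⟨P, hP.irreducible, mem_relationIdeal.1 hPmem⟩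

theorem isMinimalPolynomial_minPoly {f : k⟦X⟧} (hf : ∃ P, IsMinimalPolynomial f P) :
    IsMinimalPolynomial f (minPoly f) := by
  rw [minPoly, dif_pos hf]
  exact hf.choose_spec

theorem IsMinimalPolynomial.eq_C_C_mul {f : k⟦X⟧} {P Q : k[X][X]}
    (hP : IsMinimalPolynomial f P) (hQ : IsMinimalPolynomial f Q) :
    ∃ u : k, u ≠ 0 ∧ Q = Polynomial.C (Polynomial.C u) * P := by
  have h : Associated P Q := Ideal.span_singleton_eq_span_singleton.1 (hP.symm.trans hQ)
  obtain ⟨u, rfl⟩ := h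
  obtain ⟨r, hr, hru⟩ := Polynomial.isUnit_iff.1 u.isUnit
  obtain ⟨s, hs, rfl⟩ := Polynomial.isUnit_iff.1 hr
  exact ⟨s, hs.ne_zero, by rw [← hru, mul_comm]⟩

/-- The minimal polynomial is, up to a constant, the unique irreducible relation. -/
theorem minPoly_eq_C_C_mul {f : k⟦X⟧} {P : k[X][X]} (hP : Irreducible P)
    (h : Polynomial.aeval (R := k[X]) f P = 0) :
    ∃ u : k, u ≠ 0 ∧ minPoly f = Polynomial.C (Polynomial.C u) * P :=
  have H := isMinimalPolynomial_of_irreducible hP h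
  H.eq_C_C_mul (isMinimalPolynomial_minPoly ⟨P, H⟩)

theorem irreducible_C_C_mul {u : k} (hu : u ≠ 0) {P : k[X][X]} :
    Irreducible (Polynomial.C (Polynomial.C u) * P) ↔ Irreducible P :=
  irreducible_isUnit_mul ((isUnit_iff_ne_zero.2 hu).map (Polynomial.C.comp Polynomial.C))

theorem irreducible_minPoly {f : k⟦X⟧} (hf : IsAlgebraic k[X] f) : Irreducible (minPoly f) := by
  obtain ⟨P, hP, h⟩ := exists_irreducible_relation hf
  obtain ⟨u, hu, hu'⟩ := minPoly_eq_C_C_mul hP h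
  rwa [hu', irreducible_C_C_mul hu]

theorem aeval_minPoly {f : k⟦X⟧} (hf : IsAlgebraic k[X] f) :
    Polynomial.aeval (R := k[X]) f (minPoly f) = 0 := by
  obtain ⟨P, hP, h⟩ := exists_irreducible_relation hf
  obtain ⟨u, hu, hu'⟩ := minPoly_eq_C_C_mul hP h
  rw [hu', map_mul, h, mul_zero]

theorem IsMinimalPolynomial.dvd {f : k⟦X⟧} {P R : k[X][X]} (hP : IsMinimalPolynomial f P)
    (hR : Polynomial.aeval (R := k[X]) f R = 0) : P ∣ R := by
  rw [← Ideal.mem_span_singleton, ← hP]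
  exact mem_relationIdeal.2 hR

end Minimal

/-! ### Separability and the order of `∂P/∂T` at the root -/

section Separable

variable {k : Type*} [Field k]

theorem exists_sum_X_pow_mul_pow [IsAlgClosed k] (p : ℕ) [hp : Fact p.Prime] [CharP k p]
    (q : k[X]) : ∃ r : ℕ → k[X],
      q = ∑ i ∈ Finset.range p, (Polynomial.X : k[X]) ^ i * r i ^ p := by
  induction q using Polynomial.induction_on' with
  | add a b ha hb =>
    obtain ⟨r, hr⟩ := ha
    obtain ⟨s, hs⟩ := hb
    refine ⟨fun i => r i + s i, ?_⟩
    simp only [add_pow_char, mul_add, Finset.sum_add_distrib]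
    rw [← hr, ← hs]
  | monomial n a =>
    obtain ⟨b, hb⟩ := IsAlgClosed.exists_pow_nat_eq a hp.out.pos
    refine ⟨fun i => if i = n % p then Polynomial.C b * Polynomial.X ^ (n / p) else 0, ?_⟩
    rw [Finset.sum_eq_single (n % p)]
    · beta_reduce
      rw [if_pos rfl, mul_pow, ← Polynomial.C_pow, hb, ← pow_mul,
        ← Polynomial.C_mul_X_pow_eq_monomial, mul_left_comm, ← pow_add, mul_comm (n / p),
        Nat.mod_add_div]
    · intro i _ hi
      beta_reduce
      rw [if_neg hi, zero_pow hp.out.ne_zero, mul_zero]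
    · intro hn
      exact absurd (Finset.mem_range.2 (Nat.mod_lt _ hp.out.pos)) hn

theorem exists_expand_eq_sum [IsAlgClosed k] (p : ℕ) [hp : Fact p.Prime] [CharP k p]
    (Q : k[X][X]) : ∃ R : ℕ → k[X][X],
      Polynomial.expand k[X] p Q =
        ∑ i ∈ Finset.range p, Polynomial.C (Polynomial.X ^ i) * R i ^ p := by
  induction Q using Polynomial.induction_on' with
  | add a b ha hb =>
    obtain ⟨r, hr⟩ := ha
    obtain ⟨s, hs⟩ := hb
    refine ⟨fun i => r i + s i, ?_⟩
    simp only [add_pow_char, mul_add, Finset.sum_add_distrib, map_add]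
    rw [← hr, ← hs]
  | monomial n a =>
    obtain ⟨r, hr⟩ := exists_sum_X_pow_mul_pow p a
    refine ⟨fun i => Polynomial.C (r i) * Polynomial.X ^ n, ?_⟩
    rw [Polynomial.expand_monomial, ← Polynomial.C_mul_X_pow_eq_monomial]
    conv_lhs => rw [hr]
    rw [map_sum, Finset.sum_mul]
    refine Finset.sum_congr rfl fun i _ => ?_
    rw [mul_pow, map_mul, ← Polynomial.C_pow, ← pow_mul]
    ring

/-- `1, x, …, x^(p-1)` are linearly independent over `k((x))^p`. -/
theorem eq_zero_of_sum_X_pow_mul_pow_eq_zero (p : ℕ) [hp : Fact p.Prime] [CharP k p]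
    (g : ℕ → k⟦X⟧)
    (h : ∑ i ∈ Finset.range p, (PowerSeries.X : k⟦X⟧) ^ i * g i ^ p = 0) (i : ℕ) (hi : i < p) :
    g i = 0 := by
  have hpow : ∀ (u : k⟦X⟧) (n : ℕ), PowerSeries.coeff n (u ^ p) =
      (PowerSeries.coeff n (PowerSeries.expand p hp.out.ne_zero u)) ^ p := by
    intro u n
    rw [← MvPowerSeries.map_frobenius_expand p hp.out.ne_zero]
    rfl
  ext m
  have h1 := congrArg (PowerSeries.coeff (p * m + i)) h
  rw [map_sum, Finset.sum_eq_single i] at h1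
  · rw [add_comm (p * m), PowerSeries.coeff_X_pow_mul', if_pos (by omega), Nat.add_sub_cancel_left,
      hpow, PowerSeries.coeff_expand_mul, map_zero] at h1
    rw [map_zero]
    exact pow_eq_zero_iff hp.out.ne_zero |>.1 h1
  · intro j hj hij
    rw [PowerSeries.coeff_X_pow_mul']
    split_ifs with hle
    · rw [hpow, PowerSeries.coeff_expand_of_not_dvd, zero_pow hp.out.ne_zero]
      intro hdvd
      have hj' := Finset.mem_range.1 hj
      apply hij
      have h2 : p * m + i ≡ j [MOD p] := ((Nat.modEq_iff_dvd' hle).2 hdvd).symm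
      have h3 : i ≡ j [MOD p] := by
        have : p * m + i ≡ i [MOD p] := by simp [Nat.ModEq]
        exact this.symm.trans h2
      exact (Nat.ModEq.eq_of_lt_of_lt h3 hi hj').symm
    · rfl
  · intro hn
    exact absurd (Finset.mem_range.2 hi) hn

/-- The minimal polynomial of an algebraic power series is separable, in every characteristic:
an inseparable one would be `∑ x^i R_i^p`, and then it would divide each `R_i`. -/
theorem derivative_ne_zero_of_irreducible [IsAlgClosed k] {f : k⟦X⟧} {P : k[X][X]}
    (hP : Irreducible P) (h : Polynomial.aeval (R := k[X]) f P = 0) : derivative P ≠ 0 := by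
  intro hder
  obtain ⟨p, hchar⟩ := CharP.exists k
  rcases CharP.char_is_prime_or_zero k p with hp | hp
  · have : Fact p.Prime := ⟨hp⟩
    obtain ⟨R, hR⟩ := exists_expand_eq_sum p (Polynomial.contract p P)
    rw [Polynomial.expand_contract p hder hp.ne_zero] at hR
    have h1 := h
    rw [hR, map_sum] at h1
    simp only [map_mul, map_pow, aeval_C_series] at h1
    have h2 := eq_zero_of_sum_X_pow_mul_pow_eq_zero p _ (by simpa using h1)
    have hmin := isMinimalPolynomial_of_irreducible hP h
    have h3 : P ^ 2 ∣ P := by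
      nth_rewrite 2 [hR]
      refine Finset.dvd_sum fun i hi => Dvd.dvd.mul_left ?_ _
      exact (pow_dvd_pow P hp.two_le).trans
        (pow_dvd_pow_of_dvd (hmin.dvd (h2 i (Finset.mem_range.1 hi))) p)
    apply hP.not_isUnit
    rw [pow_two] at h3
    exact isUnit_of_dvd_one ((mul_dvd_mul_iff_left hP.ne_zero).1 (by simpa using h3))
  · subst hp
    have : CharZero k := CharP.charP_to_charZero k
    exact natDegree_ne_zero_of_aeval_eq_zero hP.ne_zero h
      (Polynomial.derivative_eq_zero.1 hder)

theorem natDegree_det_le {n : Type*} [Fintype n] [DecidableEq n] (M : Matrix n n k[X]) {h : ℕ}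
    (hM : ∀ i j, (M i j).natDegree ≤ h) : M.det.natDegree ≤ Fintype.card n * h := by
  rw [Matrix.det_apply']
  refine Polynomial.natDegree_sum_le_of_forall_le _ _ fun σ _ => ?_
  have h1 : (∏ i, M (σ i) i).natDegree ≤ Fintype.card n * h := by
    refine (Polynomial.natDegree_prod_le _ _).trans ?_
    refine (Finset.sum_le_card_nsmul _ _ h fun i _ => hM _ _).trans ?_
    simp
  rw [← Polynomial.C_eq_intCast]
  exact (Polynomial.natDegree_C_mul_le _ _).trans h1

theorem natDegree_resultant_le {P Q : k[X][X]} {m n h : ℕ} (hP : polyHeight P ≤ h)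
    (hQ : polyHeight Q ≤ h) : (Polynomial.resultant P Q m n).natDegree ≤ (m + n) * h := by
  have := natDegree_det_le (Polynomial.sylvester P Q m n) (h := h) (by
    intro i j
    rw [Polynomial.sylvester, Matrix.of_apply]
    refine Fin.addCases (fun j₁ => ?_) (fun j₁ => ?_) j
    · rw [Fin.addCases_left]
      split_ifs
      · exact polyHeight_le_iff.1 hQ _
      · simp
    · rw [Fin.addCases_right]
      split_ifs
      · exact polyHeight_le_iff.1 hP _
      · simp)
  simpa [Polynomial.resultant] using this

theorem polyHeight_derivative_le (P : k[X][X]) : polyHeight (derivative P) ≤ polyHeight P := by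
  rw [polyHeight_le_iff]
  intro j
  rw [Polynomial.coeff_derivative]
  have h1 : ((j : k[X]) + 1) = Polynomial.C ((j : k) + 1) := by simp
  rw [h1]
  exact (Polynomial.natDegree_mul_C_le _ _).trans (polyHeight_le_iff.1 le_rfl _)

theorem order_coe_le_natDegree {p : k[X]} (hp : p ≠ 0) :
    (p : k⟦X⟧).order ≤ (p.natDegree : ℕ∞) := by
  apply PowerSeries.order_le
  rw [Polynomial.coeff_coe]
  simpa using hp

/-- The discriminant bound: `(∂P/∂T)(x,f)` divides the resultant of `P` and `∂P/∂T`, of degree at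
most `(2d-1)h`. -/
theorem order_derivative_le [IsAlgClosed k] {f : k⟦X⟧} {P : k[X][X]}
    (hP : Irreducible P) (h : Polynomial.aeval (R := k[X]) f P = 0) :
    (Polynomial.aeval (R := k[X]) f (derivative P)).order ≤
      (((2 * P.natDegree - 1) * polyHeight P : ℕ) : ℕ∞) := by
  have h0 := natDegree_ne_zero_of_aeval_eq_zero hP.ne_zero h
  have hder := derivative_ne_zero_of_irreducible hP h
  have hlt : (derivative P).natDegree < P.natDegree := Polynomial.natDegree_derivative_lt h0
  have hndvd : ¬ P ∣ derivative P := fun hd =>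
    absurd (Polynomial.natDegree_le_of_dvd hd hder) (by omega)
  have hres := resultant_ne_zero_of_irreducible hP h0 hndvd
  obtain ⟨p, q, -, -, hpq⟩ := Polynomial.exists_mul_add_mul_eq_C_resultant P (derivative P)
    le_rfl le_rfl (Or.inl h0)
  have h1 := congrArg (Polynomial.aeval (R := k[X]) f) hpq
  rw [map_add, map_mul, map_mul, h, zero_mul, zero_add, aeval_C_series] at h1
  have h2 : (Polynomial.aeval (R := k[X]) f (derivative P)).order ≤
      ((Polynomial.resultant P (derivative P) : k[X]) : k⟦X⟧).order := by
    rw [← h1, PowerSeries.order_mul]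
    exact le_self_add
  refine h2.trans ((order_coe_le_natDegree hres).trans ?_)
  norm_cast
  refine (natDegree_resultant_le le_rfl (polyHeight_derivative_le P)).trans ?_
  exact Nat.mul_le_mul_right _ (by omega)

end Separable

/-! ### The implicit function theorem for power series over a ring -/

section Branch

variable {A : Type*} [CommRing A]

/-- First order expansion of `P(x, ·)` around a series. -/
theorem aeval_sub_aeval (P : A[X][X]) (f g : A⟦X⟧) :
    ∃ r : A⟦X⟧, Polynomial.aeval (R := A[X]) f P - Polynomial.aeval (R := A[X]) g P =
      (f - g) * (Polynomial.aeval (R := A[X]) g (derivative P) + r * (f - g)) := by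
  obtain ⟨r, hr⟩ := Polynomial.binomExpansion (P.map (algebraMap A[X] A⟦X⟧)) g (f - g)
  refine ⟨r, ?_⟩
  rw [add_sub_cancel, Polynomial.derivative_map] at hr
  simp only [Polynomial.eval_map_algebraMap] at hr
  rw [hr]
  ring

theorem eq_of_aeval_eq_zero {P : A[X][X]} (hP : IsUnit (((derivative P).coeff 0).coeff 0))
    {f g : A⟦X⟧} (hf : PowerSeries.constantCoeff f = 0) (hg : PowerSeries.constantCoeff g = 0)
    (h1 : Polynomial.aeval (R := A[X]) f P = 0) (h2 : Polynomial.aeval (R := A[X]) g P = 0) :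
    f = g := by
  obtain ⟨r, hr⟩ := aeval_sub_aeval P f g
  have hu : IsUnit (Polynomial.aeval (R := A[X]) g (derivative P) + r * (f - g)) := by
    rw [PowerSeries.isUnit_iff_constantCoeff, map_add, map_mul, map_sub, hf, hg, sub_zero,
      mul_zero, add_zero, constantCoeff_aeval_of_constantCoeff_eq_zero hg]
    exact hP
  rw [h1, h2, sub_zero] at hr
  exact sub_eq_zero.1 (hu.mul_left_eq_zero.1 hr.symm)

/-- A self-map of `x A⟦x⟧` which is contracting for the `x`-adic metric has a fixed point. -/
theorem exists_fixedPoint (Φ : A⟦X⟧ → A⟦X⟧)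
    (h0 : ∀ f, PowerSeries.constantCoeff f = 0 → PowerSeries.constantCoeff (Φ f) = 0)
    (hΦ : ∀ f g, PowerSeries.constantCoeff f = 0 → PowerSeries.constantCoeff g = 0 →
      ∀ n : ℕ, (PowerSeries.X : A⟦X⟧) ^ n ∣ f - g → PowerSeries.X ^ (n + 1) ∣ Φ f - Φ g) :
    ∃ f, PowerSeries.constantCoeff f = 0 ∧ Φ f = f := by
  have hit : ∀ n, PowerSeries.constantCoeff (Φ^[n] 0) = 0 := by
    intro n
    induction n with
    | zero => simp
    | succ n ih => rw [Function.iterate_succ_apply']; exact h0 _ ih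
  have hstep : ∀ n, (PowerSeries.X : A⟦X⟧) ^ n ∣ Φ^[n + 1] 0 - Φ^[n] 0 := by
    intro n
    induction n with
    | zero => simp
    | succ n ih =>
      have := hΦ _ _ (hit (n + 1)) (hit n) n ih
      rwa [← Function.iterate_succ_apply' Φ, ← Function.iterate_succ_apply' Φ] at this
  have hlater : ∀ n m, n ≤ m → (PowerSeries.X : A⟦X⟧) ^ n ∣ Φ^[m] 0 - Φ^[n] 0 := by
    intro n m hnm
    induction m, hnm using Nat.le_induction with
    | base => simp
    | succ m hnm ih =>
      have := dvd_add ((pow_dvd_pow _ hnm).trans (hstep m)) ih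
      rwa [sub_add_sub_cancel] at this
  set f : A⟦X⟧ := PowerSeries.mk fun n => PowerSeries.coeff n (Φ^[n + 1] 0) with hfdef
  have hf : ∀ n, (PowerSeries.X : A⟦X⟧) ^ n ∣ f - Φ^[n] 0 := by
    intro n
    rw [PowerSeries.X_pow_dvd_iff]
    intro m hm
    have := (PowerSeries.X_pow_dvd_iff.1 (hlater (m + 1) n hm)) m (Nat.lt_succ_self m)
    rw [map_sub, sub_eq_zero] at this
    rw [map_sub, this, hfdef, PowerSeries.coeff_mk, sub_self]
  have hf0 : PowerSeries.constantCoeff f = 0 := by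
    have := PowerSeries.X_pow_dvd_iff.1 (hf 1) 0 one_pos
    rw [map_sub, PowerSeries.coeff_zero_eq_constantCoeff, hit, sub_zero] at this
    exact this
  refine ⟨f, hf0, ?_⟩
  rw [← sub_eq_zero]
  ext n
  have h1 := hΦ f (Φ^[n] 0) hf0 (hit n) n (hf n)
  rw [← Function.iterate_succ_apply' Φ] at h1
  have h2 := dvd_sub h1 (hf (n + 1))
  rw [sub_sub_sub_cancel_right] at h2
  simpa using PowerSeries.X_pow_dvd_iff.1 h2 n (Nat.lt_succ_self n)

theorem exists_aeval_eq_zero {P : A[X][X]} (h0 : (P.coeff 0).coeff 0 = 0)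
    (h1 : ((derivative P).coeff 0).coeff 0 = 1) :
    ∃ f : A⟦X⟧, PowerSeries.constantCoeff f = 0 ∧ Polynomial.aeval (R := A[X]) f P = 0 := by
  obtain ⟨f, hf, hf'⟩ := exists_fixedPoint (fun f : A⟦X⟧ => f - Polynomial.aeval (R := A[X]) f P)
    (by
      intro f hf
      rw [map_sub, constantCoeff_aeval_of_constantCoeff_eq_zero hf, hf, h0, sub_zero])
    (by
      intro f g hf hg n hn
      obtain ⟨r, hr⟩ := aeval_sub_aeval P f g
      have : f - Polynomial.aeval (R := A[X]) f P - (g - Polynomial.aeval (R := A[X]) g P) =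
          (f - g) * (1 - (Polynomial.aeval (R := A[X]) g (derivative P) + r * (f - g))) := by
        rw [mul_sub, ← hr]; ring
      rw [this, pow_succ]
      refine mul_dvd_mul hn ?_
      rw [PowerSeries.X_dvd_iff, map_sub, map_add, map_mul, map_sub, hf, hg,
        constantCoeff_aeval_of_constantCoeff_eq_zero hg, h1]
      simp)
  exact ⟨f, hf, by simpa using hf'⟩

variable {d h : ℕ}

/-- The polynomial `T + ∑ c_{ij} x^i T^j` with vector of coefficients `c`. -/
def normalPoly (c : CoeffIndex d h → A) : A[X][X] :=
  Polynomial.X +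
    ∑ p : CoeffIndex d h, Polynomial.monomial (p.1.2 : ℕ) (Polynomial.monomial (p.1.1 : ℕ) (c p))

theorem coeff_coeff_normalPoly (c : CoeffIndex d h → A) (p : CoeffIndex d h) :
    ((normalPoly c).coeff (p.1.2 : ℕ)).coeff (p.1.1 : ℕ) = c p := by
  have hX : ((Polynomial.X : A[X][X]).coeff (p.1.2 : ℕ)).coeff (p.1.1 : ℕ) = 0 := by
    rw [Polynomial.coeff_X]
    split_ifs with h1
    · rw [Polynomial.coeff_one, if_neg]
      have := p.2
      omega
    · simp
  rw [normalPoly, Polynomial.coeff_add, Polynomial.coeff_add, hX, zero_add,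
    Polynomial.finsetSum_coeff, Polynomial.finsetSum_coeff, Finset.sum_eq_single p]
  · simp
  · intro q _ hq
    rw [Polynomial.coeff_monomial]
    split_ifs with h1
    · rw [Polynomial.coeff_monomial, if_neg]
      intro h2
      exact hq (Subtype.ext (Prod.ext (Fin.ext h2) (Fin.ext h1)))
    · simp
  · simp

theorem coeff_coeff_normalPoly_eq_zero (c : CoeffIndex d h → A) {i j : ℕ}
    (hp : ∀ p : CoeffIndex d h, ¬ ((p.1.1 : ℕ) = i ∧ (p.1.2 : ℕ) = j)) (h01 : ¬ (i = 0 ∧ j = 1)) :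
    ((normalPoly c).coeff j).coeff i = 0 := by
  have hX : ((Polynomial.X : A[X][X]).coeff j).coeff i = 0 := by
    rw [Polynomial.coeff_X]
    split_ifs with h1
    · rw [Polynomial.coeff_one, if_neg]
      omega
    · simp
  rw [normalPoly, Polynomial.coeff_add, Polynomial.coeff_add, hX, zero_add,
    Polynomial.finsetSum_coeff, Polynomial.finsetSum_coeff]
  refine Finset.sum_eq_zero fun p _ => ?_
  rw [Polynomial.coeff_monomial]
  split_ifs with h1
  · rw [Polynomial.coeff_monomial, if_neg]
    exact fun h2 => hp p ⟨h2, h1⟩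
  · simp

theorem normalPoly_coeff_one_coeff_zero (c : CoeffIndex d h → A) :
    ((normalPoly c).coeff 1).coeff 0 = 1 := by
  rw [normalPoly, Polynomial.coeff_add, Polynomial.coeff_add, Polynomial.finsetSum_coeff,
    Polynomial.finsetSum_coeff, Finset.sum_eq_zero]
  · simp
  · intro p _
    rw [Polynomial.coeff_monomial]
    split_ifs with h1
    · rw [Polynomial.coeff_monomial, if_neg]
      have := p.2
      omega
    · simp

theorem normalPoly_coeff_zero_coeff_zero (c : CoeffIndex d h → A) :
    ((normalPoly c).coeff 0).coeff 0 = 0 :=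
  coeff_coeff_normalPoly_eq_zero c (fun p hp => by have := p.2; omega) (by omega)

theorem derivative_normalPoly_coeff_zero (c : CoeffIndex d h → A) :
    ((derivative (normalPoly c)).coeff 0).coeff 0 = 1 := by
  rw [coeff_derivative_zero_zero, normalPoly_coeff_one_coeff_zero]

theorem natDegree_normalPoly_le (hd : 1 ≤ d) (c : CoeffIndex d h → A) :
    (normalPoly c).natDegree ≤ d := by
  rw [Polynomial.natDegree_le_iff_coeff_eq_zero]
  intro j hj
  ext i
  rw [Polynomial.coeff_zero]
  exact coeff_coeff_normalPoly_eq_zero c (fun p hp => by have := p.1.2.2; omega) (by omega)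

theorem map_normalPoly {B : Type*} [CommRing B] (φ : A →+* B) (c : CoeffIndex d h → A) :
    (normalPoly c).map (Polynomial.mapRingHom φ) = normalPoly (φ ∘ c) := by
  simp [normalPoly, Polynomial.map_sum, Polynomial.map_monomial]

theorem exists_branch (c : CoeffIndex d h → A) :
    ∃ f : A⟦X⟧, PowerSeries.constantCoeff f = 0 ∧
      Polynomial.aeval (R := A[X]) f (normalPoly c) = 0 :=
  exists_aeval_eq_zero (normalPoly_coeff_zero_coeff_zero c) (derivative_normalPoly_coeff_zero c)

/-- The power series vanishing at `0` defined implicitly by `T + ∑ c_{ij} x^i T^j = 0`. Its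
coefficients are polynomials in the `c_{ij}`, which is expressed by its existence over every
commutative ring and by `map_branch`. -/
def branch (c : CoeffIndex d h → A) : A⟦X⟧ := (exists_branch c).choose

theorem constantCoeff_branch (c : CoeffIndex d h → A) :
    PowerSeries.constantCoeff (branch c) = 0 := (exists_branch c).choose_spec.1

theorem aeval_branch (c : CoeffIndex d h → A) :
    Polynomial.aeval (R := A[X]) (branch c) (normalPoly c) = 0 := (exists_branch c).choose_spec.2

theorem eq_branch {c : CoeffIndex d h → A} {f : A⟦X⟧} (hf : PowerSeries.constantCoeff f = 0)
    (h : Polynomial.aeval (R := A[X]) f (normalPoly c) = 0) : f = branch c :=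
  eq_of_aeval_eq_zero (by rw [derivative_normalPoly_coeff_zero]; exact isUnit_one) hf
    (constantCoeff_branch c) h (aeval_branch c)

theorem map_aeval {B : Type*} [CommRing B] (φ : A →+* B) (f : A⟦X⟧) (P : A[X][X]) :
    PowerSeries.map φ (Polynomial.aeval (R := A[X]) f P) =
      Polynomial.aeval (R := B[X]) (PowerSeries.map φ f) (P.map (Polynomial.mapRingHom φ)) := by
  induction P using Polynomial.induction_on' with
  | add p q hp hq => simp only [map_add, Polynomial.map_add, hp, hq]
  | monomial n p =>
    rw [Polynomial.map_monomial, ← Polynomial.C_mul_X_pow_eq_monomial,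
      ← Polynomial.C_mul_X_pow_eq_monomial]
    simp only [map_mul, map_pow, aeval_C_series, Polynomial.aeval_X, Polynomial.coe_mapRingHom,
      Polynomial.polynomial_map_coe]

theorem map_branch {B : Type*} [CommRing B] (φ : A →+* B) (c : CoeffIndex d h → A) :
    PowerSeries.map φ (branch c) = branch (φ ∘ c) := by
  apply eq_branch
  · rw [← PowerSeries.coeff_zero_eq_constantCoeff_apply, PowerSeries.coeff_map,
      PowerSeries.coeff_zero_eq_constantCoeff_apply, constantCoeff_branch, map_zero]
  · rw [← map_normalPoly, ← map_aeval, aeval_branch, map_zero]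

end Branch

/-! ### Substitution of a line -/

section Line

variable {A : Type*} [CommRing A] {e : ℕ}

/-- The polynomial `a_0 x + ⋯ + a_{e-1} x^e`. -/
def headPoly (a : Fin e → A) : A[X] :=
  ∑ i : Fin e, Polynomial.C (a i) * Polynomial.X ^ ((i : ℕ) + 1)

/-- The polynomial `a(x) + x^e T` substituted for `T`, where `a = headPoly a`. -/
def line (a : Fin e → A) : A[X][X] :=
  Polynomial.C (headPoly a) + Polynomial.C (Polynomial.X ^ e) * Polynomial.X

theorem coeff_zero_headPoly (a : Fin e → A) : (headPoly a).coeff 0 = 0 := by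
  rw [headPoly, Polynomial.finsetSum_coeff]
  exact Finset.sum_eq_zero fun i _ => by simp

theorem natDegree_headPoly_le (a : Fin e → A) : (headPoly a).natDegree ≤ e := by
  refine Polynomial.natDegree_sum_le_of_forall_le _ _ fun i _ => ?_
  exact (Polynomial.natDegree_C_mul_X_pow_le _ _).trans (by have := i.2; omega)

theorem map_headPoly {B : Type*} [CommRing B] (φ : A →+* B) (a : Fin e → A) :
    (headPoly a).map φ = headPoly (φ ∘ a) := by
  simp [headPoly, Polynomial.map_sum]

theorem coeff_headPoly (a : Fin e → A) (i : Fin e) : (headPoly a).coeff ((i : ℕ) + 1) = a i := by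
  rw [headPoly, Polynomial.finsetSum_coeff, Finset.sum_eq_single i]
  · simp
  · intro j _ hj
    rw [Polynomial.coeff_C_mul_X_pow, if_neg]
    intro h
    exact hj (Fin.ext (by omega))
  · simp

theorem aeval_comp_line (a : Fin e → A) (f : A⟦X⟧) (P : A[X][X]) :
    Polynomial.aeval (R := A[X]) f (P.comp (line a)) =
      Polynomial.aeval (R := A[X]) ((headPoly a : A⟦X⟧) + PowerSeries.X ^ e * f) P := by
  rw [Polynomial.aeval_comp, line, map_add, map_mul, aeval_C_series, aeval_C_series,
    Polynomial.aeval_X, coe_X_pow]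

theorem derivative_comp_line (a : Fin e → A) (P : A[X][X]) :
    derivative (P.comp (line a)) =
      Polynomial.C (Polynomial.X ^ e) * (derivative P).comp (line a) := by
  have h : derivative (line a) = Polynomial.C (Polynomial.X ^ e) := by
    rw [line, Polynomial.derivative_add, Polynomial.derivative_C, Polynomial.derivative_C_mul,
      Polynomial.derivative_X, zero_add, mul_one]
  rw [Polynomial.derivative_comp, h]

theorem line_natDegree [IsDomain A] (a : Fin e → A) : (line a).natDegree = 1 := by
  rw [line, add_comm, Polynomial.natDegree_add_C, Polynomial.natDegree_C_mul_X]
  exact pow_ne_zero _ Polynomial.X_ne_zero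

theorem comp_line_injective [IsDomain A] (a : Fin e → A) :
    Function.Injective fun P : A[X][X] => P.comp (line a) := by
  intro P Q h
  rw [← sub_eq_zero]
  have h1 : (P - Q).comp (line a) = 0 := by rw [Polynomial.sub_comp, sub_eq_zero]; exact h
  rcases Polynomial.comp_eq_zero_iff.1 h1 with h2 | ⟨-, h2⟩
  · exact h2
  · have := congrArg Polynomial.natDegree h2
    rw [line_natDegree, Polynomial.natDegree_C] at this
    omega

theorem natDegree_comp_line [IsDomain A] (a : Fin e → A) (P : A[X][X]) :
    (P.comp (line a)).natDegree = P.natDegree := by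
  rw [Polynomial.natDegree_comp, line_natDegree, mul_one]

/-- The polynomial `x^(eD) Q(x, (T - a(x)) / x^e)`, where `D` bounds the degree of `Q`. -/
def pushLine (D : ℕ) (a : Fin e → A) (Q : A[X][X]) : A[X][X] :=
  ∑ j ∈ Finset.range (D + 1), Polynomial.C (Q.coeff j * Polynomial.X ^ (e * (D - j))) *
    (Polynomial.X - Polynomial.C (headPoly a)) ^ j

theorem pushLine_comp_line {D : ℕ} (a : Fin e → A) {Q : A[X][X]} (hQ : Q.natDegree ≤ D) :
    (pushLine D a Q).comp (line a) = Polynomial.C (Polynomial.X ^ (e * D)) * Q := by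
  rw [pushLine, ← Polynomial.coe_compRingHom_apply, map_sum]
  simp only [Polynomial.coe_compRingHom_apply]
  conv_rhs => rw [Q.as_sum_range_C_mul_X_pow' (Nat.lt_succ_of_le hQ), Finset.mul_sum]
  refine Finset.sum_congr rfl fun j hj => ?_
  have hj' : j ≤ D := Nat.lt_succ_iff.1 (Finset.mem_range.1 hj)
  have h1 : e * D = e * (D - j) + e * j := by rw [← mul_add, Nat.sub_add_cancel hj']
  rw [Polynomial.mul_comp, Polynomial.pow_comp, Polynomial.sub_comp, Polynomial.X_comp,
    Polynomial.C_comp, Polynomial.C_comp, line, add_sub_cancel_left, h1, mul_pow, pow_add,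
    pow_mul _ e j]
  simp only [map_mul, map_pow]
  ring

theorem map_pushLine {B : Type*} [CommRing B] (φ : A →+* B) (D : ℕ) (a : Fin e → A)
    (Q : A[X][X]) : (pushLine D a Q).map (Polynomial.mapRingHom φ) =
      pushLine D (φ ∘ a) (Q.map (Polynomial.mapRingHom φ)) := by
  simp [pushLine, Polynomial.map_sum, map_headPoly]

theorem natDegree_pushLine_le (D : ℕ) (a : Fin e → A) (Q : A[X][X]) :
    (pushLine D a Q).natDegree ≤ D := by
  refine Polynomial.natDegree_sum_le_of_forall_le _ _ fun j hj => ?_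
  refine (Polynomial.natDegree_C_mul_le _ _).trans (Polynomial.natDegree_pow_le_of_le j
    (Polynomial.natDegree_X_sub_C_le _) |>.trans ?_)
  have := Finset.mem_range.1 hj
  omega

end Line

/-! ### The strata in terms of equations -/

section Strata

variable {k : Type*} [Field k] {d h e : ℕ}

theorem constantCoeff_tail (e : ℕ) (f : k⟦X⟧) : PowerSeries.constantCoeff (tail e f) = 0 := by
  rw [← PowerSeries.coeff_zero_eq_constantCoeff_apply, tail, PowerSeries.coeff_mk, if_pos rfl]

theorem coe_headPoly (a : Fin e → k) : (headPoly a : k⟦X⟧) =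
    ∑ i : Fin e, PowerSeries.C (a i) * PowerSeries.X ^ ((i : ℕ) + 1) := by
  rw [headPoly, ← Polynomial.coeToPowerSeries.ringHom_apply, map_sum]
  simp

theorem headPoly_add_tail (e : ℕ) {f : k⟦X⟧} (hf : PowerSeries.constantCoeff f = 0) :
    (headPoly (head e f) : k⟦X⟧) + PowerSeries.X ^ e * tail e f = f := by
  rw [coe_headPoly, ← eq_head_add_tail e f hf]

theorem constantCoeff_headPoly_add (a : Fin e → k) {g : k⟦X⟧}
    (hg : PowerSeries.constantCoeff g = 0) :
    PowerSeries.constantCoeff ((headPoly a : k⟦X⟧) + PowerSeries.X ^ e * g) = 0 := by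
  rw [map_add, map_mul, hg, mul_zero, add_zero, ← PowerSeries.coeff_zero_eq_constantCoeff_apply,
    Polynomial.coeff_coe, coeff_zero_headPoly]

theorem head_headPoly_add (a : Fin e → k) {g : k⟦X⟧} (hg : PowerSeries.constantCoeff g = 0) :
    head e ((headPoly a : k⟦X⟧) + PowerSeries.X ^ e * g) = a := by
  funext i
  rw [head, map_add, Polynomial.coeff_coe, coeff_headPoly, PowerSeries.coeff_X_pow_mul']
  split_ifs with h1
  · have h2 : (i : ℕ) + 1 - e = 0 := by have := i.2; omega
    rw [h2, PowerSeries.coeff_zero_eq_constantCoeff_apply, hg, add_zero]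
  · rw [add_zero]

theorem tail_headPoly_add (a : Fin e → k) {g : k⟦X⟧} (hg : PowerSeries.constantCoeff g = 0) :
    tail e ((headPoly a : k⟦X⟧) + PowerSeries.X ^ e * g) = g := by
  ext n
  rw [tail, PowerSeries.coeff_mk]
  split_ifs with h0
  · rw [h0, PowerSeries.coeff_zero_eq_constantCoeff_apply, hg]
  · rw [map_add, Polynomial.coeff_coe, PowerSeries.coeff_X_pow_mul', if_pos (by omega),
      Nat.add_sub_cancel_left,
      Polynomial.coeff_eq_zero_of_natDegree_lt ((natDegree_headPoly_le a).trans_lt (by omega)),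
      zero_add]

theorem prime_C_X : Prime (Polynomial.C Polynomial.X : k[X][X]) :=
  Polynomial.prime_C_iff.2 Polynomial.prime_X

theorem not_C_X_dvd {Q : k[X][X]} (hQ : (Q.coeff 1).coeff 0 ≠ 0) :
    ¬ Polynomial.C Polynomial.X ∣ Q := by
  intro hdvd
  exact hQ (Polynomial.X_dvd_iff.1 (Polynomial.C_dvd_iff_dvd_coeff _ _ |>.1 hdvd 1))

/-- The substitution `T ↦ a(x) + x^e T` is invertible away from `x = 0`, so it preserves
irreducibility up to powers of `x`. -/
theorem irreducible_of_comp_line {P Q : k[X][X]} (a : Fin e → k) (g : k⟦X⟧) {N : ℕ}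
    (hP : Irreducible P)
    (hf : Polynomial.aeval (R := k[X]) ((headPoly a : k⟦X⟧) + PowerSeries.X ^ e * g) P = 0)
    (hPQ : P.comp (line a) = Polynomial.C (Polynomial.X ^ N) * Q)
    (hQ : ¬ Polynomial.C Polynomial.X ∣ Q) :
    Irreducible Q ∧ Polynomial.aeval (R := k[X]) g Q = 0 := by
  have hQ0 : Q ≠ 0 := by rintro rfl; exact hQ (dvd_zero _)
  have hgQ : Polynomial.aeval (R := k[X]) g Q = 0 := by
    rw [← aeval_comp_line, hPQ, map_mul, aeval_C_series, coe_X_pow] at hf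
    exact (mul_eq_zero.1 hf).resolve_left (pow_ne_zero _ PowerSeries.X_ne_zero)
  refine ⟨?_, hgQ⟩
  obtain ⟨M, hM, hgM⟩ := exists_irreducible_relation (f := g) ⟨Q, hQ0, hgQ⟩
  obtain ⟨S, hS⟩ := (isMinimalPolynomial_of_irreducible hM hgM).dvd hgQ
  have hR := pushLine_comp_line a (le_refl M.natDegree)
  have hPR : P ∣ pushLine M.natDegree a M := by
    apply (isMinimalPolynomial_of_irreducible hP hf).dvd
    rw [← aeval_comp_line, hR, map_mul, hgM, mul_zero]
  obtain ⟨W, hW⟩ := hPR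
  rw [hW, Polynomial.mul_comp, hPQ, hS] at hR
  have hdvd : S ∣ Polynomial.C Polynomial.X ^ (e * M.natDegree) := by
    refine ⟨Polynomial.C (Polynomial.X ^ N) * W.comp (line a), ?_⟩
    apply mul_right_cancel₀ hM.ne_zero
    rw [← Polynomial.C_pow, ← hR]
    ring
  obtain ⟨i, -, hi⟩ := (dvd_prime_pow prime_C_X _).1 hdvd
  have hi0 : i = 0 := by
    by_contra hne
    apply hQ
    rw [hS]
    exact ((dvd_pow_self _ hne).trans hi.symm.dvd).mul_left M
  rw [hi0, pow_zero] at hi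
  have hSu : IsUnit S := hi.symm.isUnit isUnit_one
  rw [hS]
  exact (irreducible_mul_isUnit hSu).2 hM

/-- By Taylor's formula at `f = a(x) + x^e g`, the substitution `T ↦ a(x) + x^e T` makes a relation
`P` of `f` divisible by `x^(2e)` if `∂P/∂T(x,f)` is divisible by `x^e`. -/
theorem exists_comp_line_eq {P : k[X][X]} (a : Fin e → k) (g : k⟦X⟧)
    (hf : Polynomial.aeval (R := k[X]) ((headPoly a : k⟦X⟧) + PowerSeries.X ^ e * g) P = 0)
    (hder : (PowerSeries.X : k⟦X⟧) ^ e ∣ Polynomial.aeval (R := k[X])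
      ((headPoly a : k⟦X⟧) + PowerSeries.X ^ e * g) (derivative P)) :
    ∃ Q, P.comp (line a) = Polynomial.C (Polynomial.X ^ (2 * e)) * Q := by
  set f := (headPoly a : k⟦X⟧) + PowerSeries.X ^ e * g with hfdef
  let ι : k[X] →+* k⟦X⟧ := algebraMap k[X] k⟦X⟧
  have hι : ∀ p : k[X], ι p = (p : k⟦X⟧) := fun p => rfl
  have heval : ∀ R : k[X][X], ((R.map ι).map Polynomial.C).eval (Polynomial.C f) =
      Polynomial.C (Polynomial.aeval (R := k[X]) f R) := by
    intro R
    rw [Polynomial.eval_map, Polynomial.eval₂_at_apply, Polynomial.eval_map_algebraMap]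
  obtain ⟨r, hr⟩ := Polynomial.binomExpansion ((P.map ι).map Polynomial.C)
    (Polynomial.C f) (Polynomial.C (PowerSeries.X ^ e) * (Polynomial.X - Polynomial.C g))
  have hline : (line a).map ι = Polynomial.C f +
      Polynomial.C (PowerSeries.X ^ e) * (Polynomial.X - Polynomial.C g) := by
    simp only [line, Polynomial.map_add, Polynomial.map_mul, Polynomial.map_C, Polynomial.map_X, hι,
      hfdef, coe_X_pow, map_add, map_mul]
    ring
  have hcomp : (P.comp (line a)).map ι = ((P.map ι).map Polynomial.C).eval (Polynomial.C f +
      Polynomial.C (PowerSeries.X ^ e) * (Polynomial.X - Polynomial.C g)) := by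
    rw [← hline, Polynomial.map_comp, Polynomial.comp, Polynomial.eval_map]
  rw [Polynomial.derivative_map, Polynomial.derivative_map, heval, heval, hf, map_zero, zero_add,
    ← hcomp] at hr
  obtain ⟨u, hu⟩ := hder
  have hdvd : Polynomial.C (PowerSeries.X ^ (2 * e)) ∣ (P.comp (line a)).map ι := by
    rw [hr, hu]
    refine ⟨Polynomial.C u * (Polynomial.X - Polynomial.C g) +
      r * (Polynomial.X - Polynomial.C g) ^ 2, ?_⟩
    rw [two_mul, pow_add]
    simp only [map_mul]
    ring
  have hdvd' : Polynomial.C (Polynomial.X ^ (2 * e)) ∣ P.comp (line a) := by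
    rw [Polynomial.C_dvd_iff_dvd_coeff] at hdvd ⊢
    intro j
    have := hdvd j
    rw [Polynomial.coeff_map, hι, PowerSeries.X_pow_dvd_iff] at this
    rw [Polynomial.X_pow_dvd_iff]
    intro n hn
    rw [← Polynomial.coeff_coe, this n hn]
  exact hdvd'

theorem polyHeight_line_le (a : Fin e → k) : polyHeight (line a) ≤ e := by
  rw [polyHeight_eq_natDegree_swap, line, map_add, map_mul]
  refine Polynomial.natDegree_add_le_of_degree_le ?_ ?_
  · rw [← polyHeight_eq_natDegree_swap, polyHeight_C]
    exact natDegree_headPoly_le a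
  · refine Polynomial.natDegree_mul_le.trans ?_
    rw [← polyHeight_eq_natDegree_swap, polyHeight_C, Bivariate.swap_Y]
    simp

theorem polyHeight_comp_line_le (a : Fin e → k) (P : k[X][X]) :
    polyHeight (P.comp (line a)) ≤ polyHeight P + e * P.natDegree := by
  have h1 : P.comp (line a) = ∑ j ∈ Finset.range (P.natDegree + 1),
      Polynomial.C (P.coeff j) * line a ^ j := by
    rw [Polynomial.comp, Polynomial.eval₂_eq_sum_range]
  rw [h1, polyHeight_eq_natDegree_swap, map_sum]
  refine Polynomial.natDegree_sum_le_of_forall_le _ _ fun j hj => ?_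
  rw [map_mul, map_pow]
  refine Polynomial.natDegree_mul_le.trans (add_le_add ?_ ?_)
  · rw [← polyHeight_eq_natDegree_swap, polyHeight_C]
    exact polyHeight_le_iff.1 le_rfl j
  · refine Polynomial.natDegree_pow_le.trans ?_
    rw [← polyHeight_eq_natDegree_swap, mul_comm]
    exact Nat.mul_le_mul (polyHeight_line_le a) (Nat.lt_succ_iff.1 (Finset.mem_range.1 hj))

/-- Series of degree one are unramified: their stratum is `e = 0`. -/
theorem two_le_natDegree_or_eq_zero {f : k⟦X⟧} (hf0 : PowerSeries.constantCoeff f = 0)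
    {P : k[X][X]} (hP : Irreducible P) (hf : Polynomial.aeval (R := k[X]) f P = 0)
    (hder : (Polynomial.aeval (R := k[X]) f (derivative P)).order = (e : ℕ∞)) :
    2 ≤ P.natDegree ∨ e = 0 := by
  by_contra! hcon
  have hd := natDegree_ne_zero_of_aeval_eq_zero hP.ne_zero hf
  have hd1 : P.natDegree ≤ 1 := by omega
  have hd2 : P.natDegree = 1 := by omega
  apply hcon.2
  by_contra he
  have h00 : (P.coeff 0).coeff 0 = 0 := by
    rw [← constantCoeff_aeval_of_constantCoeff_eq_zero hf0, hf, map_zero]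
  have h01 : (P.coeff 1).coeff 0 = 0 := by
    rw [← coeff_derivative_zero_zero, ← constantCoeff_aeval_of_constantCoeff_eq_zero hf0,
      ← PowerSeries.coeff_zero_eq_constantCoeff_apply]
    apply PowerSeries.coeff_of_lt_order
    rw [hder]
    exact_mod_cast Nat.pos_of_ne_zero he
  have hdvd : Polynomial.C Polynomial.X ∣ P := by
    rw [Polynomial.C_dvd_iff_dvd_coeff]
    intro j
    rw [Polynomial.X_dvd_iff]
    rcases j with _ | _ | j
    · exact h00
    · exact h01
    · have h2 : P.coeff (j + 1 + 1) = 0 := Polynomial.coeff_eq_zero_of_natDegree_lt (by omega)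
      rw [h2, Polynomial.coeff_zero]
  have hassoc := (prime_C_X.irreducible.associated_of_dvd hP hdvd)
  have := Polynomial.natDegree_eq_of_degree_eq (Polynomial.degree_eq_degree_of_associated hassoc)
  rw [Polynomial.natDegree_C] at this
  omega

theorem order_eq_of_eq_X_pow_mul {f u : k⟦X⟧} (h : f = PowerSeries.X ^ e * u)
    (hu : PowerSeries.constantCoeff u ≠ 0) : f.order = (e : ℕ∞) := by
  rw [PowerSeries.order_eq_nat]
  constructor
  · rw [h, PowerSeries.coeff_X_pow_mul', if_pos le_rfl, Nat.sub_self,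
      PowerSeries.coeff_zero_eq_constantCoeff_apply]
    exact hu
  · intro i hi
    rw [h, PowerSeries.coeff_X_pow_mul', if_neg (by omega)]

/-- The order of `∂P/∂T(x,f)` is read off the polynomial obtained by the substitution
`T ↦ a(x) + x^e T`. -/
theorem aeval_derivative_eq {P Q : k[X][X]} (a : Fin e → k) (g : k⟦X⟧)
    (hPQ : P.comp (line a) = Polynomial.C (Polynomial.X ^ (2 * e)) * Q) :
    Polynomial.aeval (R := k[X]) ((headPoly a : k⟦X⟧) + PowerSeries.X ^ e * g) (derivative P) =
      PowerSeries.X ^ e * Polynomial.aeval (R := k[X]) g (derivative Q) := by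
  have h1 := congrArg derivative hPQ
  rw [derivative_comp_line, Polynomial.derivative_C_mul] at h1
  have h2 := congrArg (Polynomial.aeval (R := k[X]) g) h1
  rw [map_mul, map_mul, aeval_comp_line, aeval_C_series, aeval_C_series, coe_X_pow, coe_X_pow,
    two_mul, pow_add, mul_assoc] at h2
  exact mul_left_cancel₀ (pow_ne_zero _ PowerSeries.X_ne_zero) h2

/-- The equation of `f⁽¹⁾` obtained from the minimal polynomial of `f`. -/
theorem exists_equation_of_mem_stratum {f : k⟦X⟧} (hf : f ∈ stratum k d h e) :
    1 ≤ d ∧ (2 ≤ d ∨ e = 0) ∧ ∃ Q : k[X][X],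
      (minPoly f).comp (line (head e f)) = Polynomial.C (Polynomial.X ^ (2 * e)) * Q ∧
      Irreducible Q ∧ Polynomial.aeval (R := k[X]) (tail e f) Q = 0 ∧
      (Q.coeff 0).coeff 0 = 0 ∧ (Q.coeff 1).coeff 0 ≠ 0 ∧
      Q.natDegree ≤ d ∧ polyHeight Q ≤ h + e * (d - 2) := by
  obtain ⟨⟨⟨halg, hdeg, hheight⟩, hf0⟩, hord⟩ := hf
  rw [seriesDegree] at hdeg
  rw [seriesHeight] at hheight
  have hP := irreducible_minPoly halg
  have hPf := aeval_minPoly halg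
  have htail := headPoly_add_tail e hf0
  have hdeg0 := natDegree_ne_zero_of_aeval_eq_zero hP.ne_zero hPf
  have hde := two_le_natDegree_or_eq_zero hf0 hP hPf hord
  set P := minPoly f
  obtain ⟨Q, hQ⟩ := exists_comp_line_eq (P := P) (head e f) (tail e f) (by rw [htail, hPf])
    (by rw [htail]; exact PowerSeries.X_pow_dvd_iff.2 fun m hm =>
          PowerSeries.coeff_of_lt_order _ (by rw [hord]; exact_mod_cast hm))
  have hder := aeval_derivative_eq (head e f) (tail e f) hQ
  rw [htail] at hder
  have hQ1 : (Q.coeff 1).coeff 0 ≠ 0 := by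
    rw [← coeff_derivative_zero_zero,
      ← constantCoeff_aeval_of_constantCoeff_eq_zero (constantCoeff_tail e f)]
    have h1 := (PowerSeries.order_eq_nat.1 hord).1
    rw [hder, PowerSeries.coeff_X_pow_mul', if_pos le_rfl, Nat.sub_self,
      PowerSeries.coeff_zero_eq_constantCoeff_apply] at h1
    exact h1
  obtain ⟨hQirr, hQtail⟩ := irreducible_of_comp_line (head e f) (tail e f) hP
    (by rw [htail, hPf]) hQ (not_C_X_dvd hQ1)
  have hX : (Polynomial.C (Polynomial.X ^ (2 * e)) : k[X][X]) ≠ 0 := by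
    simp
  have hQdeg : Q.natDegree = P.natDegree := by
    rw [← natDegree_comp_line (head e f) P, hQ, Polynomial.natDegree_C_mul]
    exact pow_ne_zero _ Polynomial.X_ne_zero
  refine ⟨by omega, by omega, Q, hQ, hQirr, hQtail, ?_, hQ1, hQdeg.trans_le hdeg, ?_⟩
  · rw [← constantCoeff_aeval_of_constantCoeff_eq_zero (constantCoeff_tail e f), hQtail, map_zero]
  · have h1 := polyHeight_comp_line_le (head e f) P
    rw [hQ, polyHeight_mul hX hQirr.ne_zero, polyHeight_C, Polynomial.natDegree_X_pow] at h1
    rcases hde with h2 | h2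
    · obtain ⟨m, hm⟩ := Nat.exists_eq_add_of_le h2
      have h3 : e * m ≤ e * (d - 2) := Nat.mul_le_mul_left _ (by omega)
      rw [hm, mul_add] at h1
      omega
    · subst h2
      omega

theorem mapsTo_tail : Set.MapsTo (tail e) (stratum k d h e)
    (implicitSet k d (h + e * (d - 2))) := by
  intro f hf
  obtain ⟨-, -, Q, -, hQirr, hQtail, hQ0, hQ1, hQd, hQh⟩ := exists_equation_of_mem_stratum hf
  obtain ⟨u, hu, hmin⟩ := minPoly_eq_C_C_mul hQirr hQtail
  refine ⟨⟨⟨⟨Q, hQirr.ne_zero, hQtail⟩, ?_, ?_⟩, constantCoeff_tail e f⟩, ?_, ?_⟩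
  · rw [seriesDegree, hmin, natDegree_C_C_mul hu]
    exact hQd
  · rw [seriesHeight, hmin, polyHeight_C_C_mul hu]
    exact hQh
  · rw [eval_eval_zero, hmin, Polynomial.coeff_C_mul, Polynomial.coeff_C_mul, hQ0, mul_zero]
  · rw [eval_eval_zero, coeff_derivative_zero_zero, hmin, Polynomial.coeff_C_mul,
      Polynomial.coeff_C_mul]
    exact mul_ne_zero hu hQ1

theorem psi_eq {g : k⟦X⟧} {c : CoeffIndex d h → k} {u : k} (hu : u ≠ 0)
    (hg : minPoly g = Polynomial.C (Polynomial.C u) * normalPoly c) : psi d h g = c := by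
  funext p
  rw [psi, hg, Polynomial.coeff_C_mul, Polynomial.coeff_C_mul, Polynomial.coeff_C_mul,
    Polynomial.coeff_C_mul, coeff_coeff_normalPoly, normalPoly_coeff_one_coeff_zero, mul_one,
    mul_div_cancel_left₀ _ hu]

theorem minPoly_eq_normalPoly_psi {g : k⟦X⟧} (hg : g ∈ implicitSet k d h) :
    minPoly g = Polynomial.C (Polynomial.C (((minPoly g).coeff 1).coeff 0)) *
      normalPoly (psi d h g) := by
  obtain ⟨⟨⟨-, hdeg, hheight⟩, -⟩, h0, h1⟩ := hg
  rw [seriesDegree] at hdeg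
  rw [seriesHeight] at hheight
  rw [eval_eval_zero] at h0
  rw [eval_eval_zero, coeff_derivative_zero_zero] at h1
  ext j i
  rw [Polynomial.coeff_C_mul, Polynomial.coeff_C_mul]
  by_cases hp : ∃ p : CoeffIndex d h, (p.1.1 : ℕ) = i ∧ (p.1.2 : ℕ) = j
  · obtain ⟨p, rfl, rfl⟩ := hp
    rw [coeff_coeff_normalPoly, psi, mul_div_cancel₀ _ h1]
  · push Not at hp
    by_cases h01 : i = 0 ∧ j = 1
    · rw [h01.1, h01.2, normalPoly_coeff_one_coeff_zero, mul_one]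
    · rw [coeff_coeff_normalPoly_eq_zero _ (fun p hp' => hp p hp'.1 hp'.2) h01, mul_zero]
      by_cases h00 : i = 0 ∧ j = 0
      · rw [h00.1, h00.2, h0]
      by_cases hi : h < i
      · exact polyHeight_le_iff_coeff.1 hheight i j hi
      by_cases hj : d < j
      · rw [Polynomial.coeff_eq_zero_of_natDegree_lt (hdeg.trans_lt hj), Polynomial.coeff_zero]
      exact absurd rfl (hp ⟨(⟨i, by omega⟩, ⟨j, by omega⟩), by
        change i ≠ 0 ∨ 2 ≤ j
        omega⟩ rfl)

theorem eq_branch_psi {g : k⟦X⟧} (hg : g ∈ implicitSet k d h) : g = branch (psi d h g) := by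
  have h1 := hg.2.2
  rw [eval_eval_zero, coeff_derivative_zero_zero] at h1
  apply eq_branch hg.1.2
  have h2 := aeval_minPoly hg.1.1.1
  rw [minPoly_eq_normalPoly_psi hg, map_mul, aeval_C_series] at h2
  exact (mul_eq_zero.1 h2).resolve_left (coe_ne_zero_of_ne_zero (by simpa using h1))

/-- The point of the stratum with coordinates `v`. -/
def chartSeries {A : Type*} [CommRing A] (v : ChartIndex d h e → A) : A⟦X⟧ :=
  (headPoly (v ∘ Sum.inl) : A⟦X⟧) + PowerSeries.X ^ e * branch (v ∘ Sum.inr)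

theorem map_chartSeries {A B : Type*} [CommRing A] [CommRing B] (φ : A →+* B)
    (v : ChartIndex d h e → A) :
    PowerSeries.map φ (chartSeries v) = chartSeries (φ ∘ v) := by
  rw [chartSeries, map_add, map_mul, map_pow, map_branch, PowerSeries.map_X,
    ← Polynomial.polynomial_map_coe, map_headPoly]
  rfl

theorem chartSeries_chart {f : k⟦X⟧} (hf : f ∈ stratum k d h e) :
    chartSeries (chart d h e f) = f := by
  have h1 : chart d h e f ∘ Sum.inl = head e f := rfl
  have h2 : chart d h e f ∘ Sum.inr = psi d (h + e * (d - 2)) (tail e f) := rfl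
  rw [chartSeries, h1, h2, ← eq_branch_psi (mapsTo_tail hf), headPoly_add_tail e hf.1.2]

theorem injOn_chart : Set.InjOn (chart d h e) (stratum k d h e) := by
  intro f hf g hg hfg
  rw [← chartSeries_chart hf, hfg, chartSeries_chart hg]

theorem stratumImage_subset : stratumImage k d h e ⊆
    {v | v ∘ Sum.inr ∈ implicitImage k d (h + e * (d - 2))} := by
  rintro _ ⟨f, hf, rfl⟩
  exact ⟨tail e f, mapsTo_tail hf, rfl⟩

theorem constantCoeff_chartSeries (v : ChartIndex d h e → k) :
    PowerSeries.constantCoeff (chartSeries v) = 0 :=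
  constantCoeff_headPoly_add _ (constantCoeff_branch _)

/-- The equation satisfied by the point with coordinates `v`. -/
theorem aeval_chartSeries {A : Type*} [CommRing A] [IsDomain A] {v : ChartIndex d h e → A}
    {P : A[X][X]} {N : ℕ} (hP : P.comp (line (v ∘ Sum.inl)) =
      Polynomial.C (Polynomial.X ^ N) * normalPoly (v ∘ Sum.inr)) :
    Polynomial.aeval (R := A[X]) (chartSeries v) P = 0 := by
  rw [chartSeries, ← aeval_comp_line, hP, map_mul, aeval_branch, mul_zero]

/-- Equational description of the image of a stratum. -/
theorem mem_stratumImage_iff {v : ChartIndex d h e → k} :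
    v ∈ stratumImage k d h e ↔ ∃ P : k[X][X], Irreducible P ∧ P.natDegree ≤ d ∧
      polyHeight P ≤ h ∧ P.comp (line (v ∘ Sum.inl)) =
        Polynomial.C (Polynomial.X ^ (2 * e)) * normalPoly (v ∘ Sum.inr) := by
  constructor
  · rintro ⟨f, hf, rfl⟩
    obtain ⟨-, -, Q, hPQ, hQirr, hQtail, hQ0, hQ1, hQd, hQh⟩ := exists_equation_of_mem_stratum hf
    obtain ⟨u, hu, hmin⟩ := minPoly_eq_C_C_mul hQirr hQtail
    have h1 : chart d h e f ∘ Sum.inl = head e f := rfl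
    have h2 : chart d h e f ∘ Sum.inr = psi d (h + e * (d - 2)) (tail e f) := rfl
    have h3 := minPoly_eq_normalPoly_psi (mapsTo_tail hf)
    rw [hmin, Polynomial.coeff_C_mul, Polynomial.coeff_C_mul] at h3
    set q := (Q.coeff 1).coeff 0
    have h4 : Q = Polynomial.C (Polynomial.C q) *
        normalPoly (psi d (h + e * (d - 2)) (tail e f)) := by
      rw [map_mul, map_mul, mul_assoc] at h3
      exact mul_left_cancel₀ (by simpa using hu) h3
    refine ⟨Polynomial.C (Polynomial.C q⁻¹) * minPoly f, ?_, ?_, ?_, ?_⟩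
    · rw [irreducible_C_C_mul (inv_ne_zero hQ1)]
      exact irreducible_minPoly hf.1.1.1
    · rw [natDegree_C_C_mul (inv_ne_zero hQ1)]
      exact hf.1.1.2.1
    · rw [polyHeight_C_C_mul (inv_ne_zero hQ1)]
      exact hf.1.1.2.2
    · rw [Polynomial.mul_comp, Polynomial.C_comp, h1, h2, hPQ, mul_left_comm, h4, ← mul_assoc
        (Polynomial.C (Polynomial.C q⁻¹)), ← map_mul, ← map_mul, inv_mul_cancel₀ hQ1, map_one,
        map_one, one_mul]
  · rintro ⟨P, hP, hPd, hPh, hPQ⟩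
    have hroot := aeval_chartSeries hPQ
    have hbr := constantCoeff_branch (v ∘ Sum.inr)
    obtain ⟨u, hu, hmin⟩ := minPoly_eq_C_C_mul hP hroot
    have hQ1 : ((normalPoly (v ∘ Sum.inr)).coeff 1).coeff 0 ≠ 0 := by
      rw [normalPoly_coeff_one_coeff_zero]; exact one_ne_zero
    obtain ⟨hQirr, hQroot⟩ := irreducible_of_comp_line (v ∘ Sum.inl) (branch (v ∘ Sum.inr)) hP
      hroot hPQ (not_C_X_dvd hQ1)
    obtain ⟨w, hw, hmin'⟩ := minPoly_eq_C_C_mul hQirr hQroot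
    refine ⟨chartSeries v, ⟨⟨⟨⟨P, hP.ne_zero, hroot⟩, ?_, ?_⟩, constantCoeff_chartSeries v⟩, ?_⟩, ?_⟩
    · rw [seriesDegree, hmin, natDegree_C_C_mul hu]
      exact hPd
    · rw [seriesHeight, hmin, polyHeight_C_C_mul hu]
      exact hPh
    · rw [hmin, Polynomial.derivative_C_mul, map_mul, aeval_C_series, chartSeries,
        aeval_derivative_eq _ _ hPQ, mul_left_comm]
      refine order_eq_of_eq_X_pow_mul rfl ?_
      rw [map_mul, constantCoeff_aeval_of_constantCoeff_eq_zero hbr,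
        derivative_normalPoly_coeff_zero, mul_one]
      simpa using hu
    · rw [chart, chartSeries, head_headPoly_add _ hbr, tail_headPoly_add _ hbr, psi_eq hw hmin']
      exact Sum.elim_comp_inl_inr v

end Strata

/-! ### The stratification -/

section Stratification

variable {k : Type*} [Field k] [IsAlgClosed k] {d h : ℕ}

theorem exists_mem_stratum {f : k⟦X⟧} (hf : f ∈ algSetZero k d h) :
    ∃ e ≤ (2 * d - 1) * h, f ∈ stratum k d h e := by
  have h1 := order_derivative_le (irreducible_minPoly hf.1.1) (aeval_minPoly hf.1.1)
  have h2 : (2 * (minPoly f).natDegree - 1) * polyHeight (minPoly f) ≤ (2 * d - 1) * h :=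
    Nat.mul_le_mul (by have := hf.1.2.1; rw [seriesDegree] at this; omega) hf.1.2.2
  obtain ⟨e, he⟩ := ENat.ne_top_iff_exists.1 (ne_top_of_le_ne_top (ENat.natCast_ne_top _) h1)
  refine ⟨e, ?_, hf, he.symm⟩
  rw [← he] at h1
  exact (Nat.cast_le.1 h1).trans h2

theorem algSetZero_eq_iUnion :
    algSetZero k d h = ⋃ e ∈ Set.Iic (2 * d * h), stratum k d h e := by
  ext f
  simp only [Set.mem_iUnion, Set.mem_Iic, exists_prop]
  constructor
  · intro hf
    obtain ⟨e, he, hfe⟩ := exists_mem_stratum hf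
    exact ⟨e, he.trans (Nat.mul_le_mul_right _ (Nat.sub_le _ _)), hfe⟩
  · rintro ⟨e, -, hfe⟩
    exact hfe.1

end Stratification

/-! ### Constructible sets -/

section Constructible

variable {k : Type*} [Field k] {σ τ : Type*}

theorem isConstructibleSet_forall (T : Set (MvPolynomial σ k)) :
    IsConstructibleSet {v : σ → k | ∀ p ∈ T, MvPolynomial.eval v p = 0} := by
  refine BooleanSubalgebra.subset_closure ⟨Ideal.span T, ?_⟩
  rw [MvPolynomial.zeroLocus_span]
  rfl

theorem IsConstructibleSet.compl {S : Set (σ → k)} (hS : IsConstructibleSet S) :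
    IsConstructibleSet Sᶜ :=
  BooleanSubalgebra.compl_mem hS

theorem IsConstructibleSet.inter {S S' : Set (σ → k)} (hS : IsConstructibleSet S)
    (hS' : IsConstructibleSet S') : IsConstructibleSet (S ∩ S') :=
  BooleanSubalgebra.inf_mem hS hS'

theorem IsConstructibleSet.union {S S' : Set (σ → k)} (hS : IsConstructibleSet S)
    (hS' : IsConstructibleSet S') : IsConstructibleSet (S ∪ S') :=
  BooleanSubalgebra.sup_mem hS hS'

theorem isConstructibleSet_empty : IsConstructibleSet (∅ : Set (σ → k)) :=
  BooleanSubalgebra.bot_mem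

theorem isConstructibleSet_biUnion {ι : Type*} {s : Set ι} (hs : s.Finite)
    {S : ι → Set (σ → k)} (hS : ∀ i ∈ s, IsConstructibleSet (S i)) :
    IsConstructibleSet (⋃ i ∈ s, S i) := by
  induction s, hs using Set.Finite.induction_on with
  | empty => simpa using isConstructibleSet_empty
  | @insert a s ha hs ih =>
    rw [Set.biUnion_insert]
    exact (hS a (Set.mem_insert _ _)).union (ih fun i hi => hS i (Set.mem_insert_of_mem _ hi))

theorem isConstructibleSet_iUnion {ι : Type*} [Finite ι] {S : ι → Set (σ → k)}
    (hS : ∀ i, IsConstructibleSet (S i)) : IsConstructibleSet (⋃ i, S i) := by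
  have := isConstructibleSet_biUnion (Set.finite_univ (α := ι)) (S := S) fun i _ => hS i
  simpa using this

theorem IsConstructibleSet.preimage {S : Set (σ → k)} (hS : IsConstructibleSet S)
    (F : σ → MvPolynomial τ k) :
    IsConstructibleSet {v : τ → k | (fun s => MvPolynomial.eval v (F s)) ∈ S} := by
  refine BooleanSubalgebra.closure_bot_sup_induction
    (p := fun S _ => IsConstructibleSet {v : τ → k | (fun s => MvPolynomial.eval v (F s)) ∈ S})
    ?_ ?_ ?_ ?_ hS
  · rintro _ ⟨I, rfl⟩
    convert isConstructibleSet_forall (MvPolynomial.bind₁ F '' (I : Set (MvPolynomial σ k)))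
      using 1
    ext v
    simp only [Set.mem_ofPred_eq, MvPolynomial.mem_zeroLocus_iff, Set.forall_mem_image,
      SetLike.mem_coe]
    refine forall₂_congr fun p _ => ?_
    simp only [← MvPolynomial.coe_aeval_eq_eval, RingHom.coe_coe, MvPolynomial.aeval_bind₁]
  · exact isConstructibleSet_empty
  · intro S _ S' _ h1 h2
    exact h1.union h2
  · intro S _ h1
    exact h1.compl

/-- The coordinates of an affine map, as polynomials. -/
def affinePoly [Fintype σ] [DecidableEq σ] (φ : (σ → k) →ᵃ[k] (τ → k)) (t : τ) :
    MvPolynomial σ k :=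
  MvPolynomial.C (φ 0 t) +
    ∑ s, MvPolynomial.C (φ.linear (Pi.single s 1) t) * MvPolynomial.X s

theorem eval_affinePoly [Fintype σ] [DecidableEq σ] (φ : (σ → k) →ᵃ[k] (τ → k)) (t : τ)
    (v : σ → k) : MvPolynomial.eval v (affinePoly φ t) = φ v t := by
  have h1 : φ v = φ.linear v + φ 0 := by
    have := φ.linearMap_vsub v 0
    simp only [vsub_eq_sub, sub_zero] at this
    rw [this, sub_add_cancel]
  have h2 : φ.linear v = ∑ s, v s • φ.linear (Pi.single s 1) := by
    conv_lhs => rw [pi_eq_sum_univ' v]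
    rw [map_sum]
    refine Finset.sum_congr rfl fun s _ => ?_
    rw [map_smul]
  rw [h1, h2, affinePoly]
  simp [Finset.sum_apply, mul_comm, add_comm]

theorem exists_affine_leftInverse {φ : (σ → k) →ᵃ[k] (τ → k)} (hφ : Function.Injective φ) :
    ∃ ρ : (τ → k) →ᵃ[k] (σ → k), ∀ v, ρ (φ v) = v := by
  obtain ⟨L, hL⟩ := LinearMap.exists_leftInverse_of_injective φ.linear
    (LinearMap.ker_eq_bot.2 (φ.linear_injective_iff.2 hφ))
  refine ⟨L.toAffineMap - AffineMap.const k _ (L (φ 0)), fun v => ?_⟩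
  have h1 : φ.linear v = φ v - φ 0 := by
    have := φ.linearMap_vsub v 0
    simpa using this
  have h2 := LinearMap.congr_fun hL v
  simp only [LinearMap.comp_apply, LinearMap.id_apply] at h2
  change L (φ v) - L (φ 0) = v
  rw [← map_sub, ← h1, h2]

theorem IsConstructibleSet.image_affine [Fintype σ] [Fintype τ] {S : Set (σ → k)}
    (hS : IsConstructibleSet S) {φ : (σ → k) →ᵃ[k] (τ → k)} (hφ : Function.Injective φ) :
    IsConstructibleSet (φ '' S) := by
  classical
  obtain ⟨ρ, hρ⟩ := exists_affine_leftInverse hφ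
  have h1 := hS.preimage (affinePoly ρ)
  have h2 := isConstructibleSet_forall (Set.range fun t =>
    MvPolynomial.X t - affinePoly (φ.comp ρ) t)
  convert h1.inter h2 using 1
  ext w
  simp only [Set.mem_inter_iff, Set.mem_ofPred_eq, Set.forall_mem_range, eval_affinePoly, map_sub,
    MvPolynomial.eval_X, AffineMap.comp_apply, sub_eq_zero]
  constructor
  · rintro ⟨v, hv, rfl⟩
    rw [hρ]
    exact ⟨hv, fun _ => rfl⟩
  · rintro ⟨hw, hw'⟩
    exact ⟨ρ w, hw, (funext hw').symm⟩

/-- A family of linear forms on `k^ι` has no common zero iff `|ι|` of them have none, which is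
detected by a minor. -/
theorem forall_eq_zero_iff_exists_minor {ι ρ : Type*} [Fintype ι] [DecidableEq ι]
    (m : ρ → ι → k) : (∀ R : ι → k, (∀ n, ∑ i, R i * m n i = 0) → R = 0) ↔
      ∃ g : ι → ρ, (Matrix.of fun i j => m (g i) j).det ≠ 0 := by
  constructor
  · intro H
    have hspan : Submodule.span k (Set.range m) = ⊤ := by
      by_contra hne
      obtain ⟨φ, hφ0, hφ⟩ := Submodule.exists_le_ker_of_lt_top _ (lt_top_iff_ne_top.2 hne)
      apply hφ0
      have hφR : ∀ x, φ x = ∑ i, φ (Pi.single i 1) * x i := by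
        intro x
        conv_lhs => rw [pi_eq_sum_univ' x]
        rw [map_sum]
        refine Finset.sum_congr rfl fun s _ => ?_
        rw [map_smul, smul_eq_mul, mul_comm]
      have := H (fun i => φ (Pi.single i 1)) fun n => by
        rw [← hφR]
        exact hφ (Submodule.subset_span ⟨n, rfl⟩)
      ext i
      exact congrFun this i
    obtain ⟨b, hb, hbspan, hbind⟩ := exists_linearIndependent k (Set.range m)
    rw [hspan] at hbspan
    let B := Module.Basis.mk hbind (by rw [Subtype.range_coe, hbspan])
    have : Fintype b := FiniteDimensional.fintypeBasisIndex B
    have hcard : Fintype.card ι = Fintype.card b := by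
      rw [← Module.finrank_eq_card_basis B, Module.finrank_fintype_fun_eq_card]
    let E := Fintype.equivOfCardEq hcard
    have hpre : ∀ i : ι, ∃ n, m n = (E i : ι → k) := fun i => hb (E i).2
    choose g hg using hpre
    refine ⟨g, ?_⟩
    have hli : LinearIndependent k (fun i => m (g i)) := by
      simp only [hg]
      exact hbind.comp E E.injective
    have : IsUnit (Matrix.of fun i j => m (g i) j) :=
      Matrix.linearIndependent_rows_iff_isUnit.1 hli
    exact ((Matrix.isUnit_iff_isUnit_det _).1 this).ne_zero
  · rintro ⟨g, hg⟩ R hR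
    refine Matrix.eq_zero_of_mulVec_eq_zero hg ?_
    ext i
    simp only [Matrix.mulVec, dotProduct, Matrix.of_apply, Pi.zero_apply]
    rw [← hR (g i)]
    exact Finset.sum_congr rfl fun j _ => mul_comm _ _

/-- Injectivity of a matrix of polynomials with possibly infinitely many rows is an open
condition, given by the nonvanishing of some maximal minor. -/
theorem forall_eq_zero_iff_exists_eval_det {ι ρ : Type*} [Fintype ι] [DecidableEq ι]
    (m : ρ → ι → MvPolynomial σ k) (v : σ → k) :
    (∀ R : ι → k, (∀ n, ∑ i, R i * MvPolynomial.eval v (m n i) = 0) → R = 0) ↔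
      ∃ g : ι → ρ, MvPolynomial.eval v (Matrix.of fun i j => m (g i) j).det ≠ 0 := by
  rw [forall_eq_zero_iff_exists_minor (fun n i => MvPolynomial.eval v (m n i))]
  refine exists_congr fun g => ?_
  rw [RingHom.map_det]
  rfl

theorem isConstructibleSet_injective {ι ρ : Type*} [Fintype ι] [DecidableEq ι]
    (m : ρ → ι → MvPolynomial σ k) :
    IsConstructibleSet {v : σ → k |
      ∀ R : ι → k, (∀ n, ∑ i, R i * MvPolynomial.eval v (m n i) = 0) → R = 0} := by
  have h := (isConstructibleSet_forall (Set.range fun g : ι → ρ =>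
    (Matrix.of fun i j => m (g i) j).det)).compl
  convert h using 1
  ext v
  rw [Set.mem_ofPred_eq, forall_eq_zero_iff_exists_eval_det]
  simp

end Constructible

/-! ### Irreducibility of a relation as a condition of linear algebra -/

section Box

variable {k : Type*} [Field k] {d h : ℕ}

/-- The polynomial of degree at most `d` and height at most `h` with coefficients `R`. -/
def boxPoly {A : Type*} [CommRing A] (R : Fin (h + 1) × Fin (d + 1) → A) : A[X][X] :=
  ∑ p, Polynomial.monomial (p.2 : ℕ) (Polynomial.monomial (p.1 : ℕ) (R p))

theorem coeff_coeff_boxPoly {A : Type*} [CommRing A] (R : Fin (h + 1) × Fin (d + 1) → A)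
    (p : Fin (h + 1) × Fin (d + 1)) : ((boxPoly R).coeff p.2).coeff p.1 = R p := by
  rw [boxPoly, Polynomial.finsetSum_coeff, Polynomial.finsetSum_coeff, Finset.sum_eq_single p]
  · simp
  · intro q _ hq
    rw [Polynomial.coeff_monomial]
    split_ifs with h1
    · rw [Polynomial.coeff_monomial, if_neg]
      exact fun h2 => hq (Prod.ext (Fin.ext h2) (Fin.ext h1))
    · simp
  · simp

theorem coeff_coeff_boxPoly_eq_zero {A : Type*} [CommRing A]
    (R : Fin (h + 1) × Fin (d + 1) → A) {i j : ℕ} (hij : h < i ∨ d < j) :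
    ((boxPoly R).coeff j).coeff i = 0 := by
  rw [boxPoly, Polynomial.finsetSum_coeff, Polynomial.finsetSum_coeff]
  refine Finset.sum_eq_zero fun p _ => ?_
  rw [Polynomial.coeff_monomial]
  split_ifs with h1
  · rw [Polynomial.coeff_monomial, if_neg]
    have := p.1.2
    have := p.2.2
    omega
  · simp

theorem eq_boxPoly {A : Type*} [CommRing A] {P : A[X][X]}
    (hP : ∀ i j, h < i ∨ d < j → (P.coeff j).coeff i = 0) :
    P = boxPoly fun p : Fin (h + 1) × Fin (d + 1) => (P.coeff p.2).coeff p.1 := by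
  ext j i
  by_cases hij : h < i ∨ d < j
  · rw [hP i j hij, coeff_coeff_boxPoly_eq_zero _ hij]
  · exact (coeff_coeff_boxPoly (fun p : Fin (h + 1) × Fin (d + 1) => (P.coeff p.2).coeff p.1)
      (⟨i, by omega⟩, ⟨j, by omega⟩)).symm

theorem natDegree_le_and_polyHeight_le_iff {P : k[X][X]} :
    (P.natDegree ≤ d ∧ polyHeight P ≤ h) ↔ ∀ i j, h < i ∨ d < j → (P.coeff j).coeff i = 0 := by
  constructor
  · rintro ⟨h1, h2⟩ i j (hi | hj)
    · exact polyHeight_le_iff_coeff.1 h2 i j hi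
    · rw [Polynomial.coeff_eq_zero_of_natDegree_lt (h1.trans_lt hj), Polynomial.coeff_zero]
  · intro H
    refine ⟨Polynomial.natDegree_le_iff_coeff_eq_zero.2 fun j hj => ?_,
      polyHeight_le_iff_coeff.2 fun i j hi => H i j (Or.inl hi)⟩
    ext i
    rw [H i j (Or.inr hj), Polynomial.coeff_zero]

theorem coeff_aeval_boxPoly {A : Type*} [CommRing A] (R : Fin (h + 1) × Fin (d + 1) → A)
    (f : A⟦X⟧) (n : ℕ) :
    PowerSeries.coeff n (Polynomial.aeval (R := A[X]) f (boxPoly R)) =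
      ∑ p, R p * PowerSeries.coeff n (PowerSeries.X ^ (p.1 : ℕ) * f ^ (p.2 : ℕ)) := by
  rw [boxPoly, map_sum, map_sum]
  refine Finset.sum_congr rfl fun p _ => ?_
  rw [← Polynomial.C_mul_X_pow_eq_monomial, map_mul, map_pow, Polynomial.aeval_X, aeval_C_series,
    ← Polynomial.C_mul_X_pow_eq_monomial, Polynomial.coe_mul, coe_X_pow, Polynomial.coe_C,
    mul_assoc, PowerSeries.coeff_C_mul]

/-- The relations of `f` of degree at most `d` and height at most `h` form at most a line, on which
the coordinate `s` is injective. -/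
def RigidAt (f : k⟦X⟧) (s : Fin (h + 1) × Fin (d + 1)) : Prop :=
  ∀ R : Fin (h + 1) × Fin (d + 1) → k, R s = 0 →
    Polynomial.aeval (R := k[X]) f (boxPoly R) = 0 → R = 0

theorem Irreducible.rigidAt {f : k⟦X⟧} {P : k[X][X]} (hP : Irreducible P)
    (hf : Polynomial.aeval (R := k[X]) f P = 0) (hd : P.natDegree = d) (hh : polyHeight P = h)
    {s : Fin (h + 1) × Fin (d + 1)} (hs : (P.coeff s.2).coeff s.1 ≠ 0) : RigidAt f s := by
  intro R hR hfR
  obtain ⟨S, hS⟩ := (isMinimalPolynomial_of_irreducible hP hf).dvd hfR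
  have hbox : ∀ i j, h < i ∨ d < j → ((boxPoly R).coeff j).coeff i = 0 :=
    fun i j => coeff_coeff_boxPoly_eq_zero R
  obtain ⟨h1, h2⟩ := natDegree_le_and_polyHeight_le_iff.2 hbox
  have hS0 : S = 0 := by
    by_contra hS0
    rw [hS, Polynomial.natDegree_mul hP.ne_zero hS0] at h1
    rw [hS, polyHeight_mul hP.ne_zero hS0] at h2
    obtain ⟨u, rfl⟩ := eq_C_C_of_natDegree_of_polyHeight (P := S) (by omega) (by omega)
    have h3 := coeff_coeff_boxPoly R s
    rw [hS, hR, Polynomial.coeff_mul_C, Polynomial.coeff_mul_C] at h3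
    rcases mul_eq_zero.1 h3 with h4 | h4
    · exact hs h4
    · exact hS0 (by simp [h4])
  funext p
  rw [← coeff_coeff_boxPoly R p, hS, hS0]
  simp

theorem RigidAt.irreducible {f : k⟦X⟧} {P : k[X][X]}
    (hf : Polynomial.aeval (R := k[X]) f P = 0) (hd : P.natDegree ≤ d) (hh : polyHeight P ≤ h)
    {s : Fin (h + 1) × Fin (d + 1)} (hs : (P.coeff s.2).coeff s.1 ≠ 0) (H : RigidAt f s) :
    Irreducible P := by
  have hP0 : P ≠ 0 := by
    rintro rfl
    simp at hs
  obtain ⟨M, hM, hfM⟩ := exists_irreducible_relation (f := f) ⟨P, hP0, hf⟩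
  obtain ⟨S, hS⟩ := (isMinimalPolynomial_of_irreducible hM hfM).dvd hf
  have hS0 : S ≠ 0 := by
    rintro rfl
    exact hP0 (by rw [hS, mul_zero])
  have hMd : M.natDegree ≤ d := by
    rw [hS, Polynomial.natDegree_mul hM.ne_zero hS0] at hd
    omega
  have hMh : polyHeight M ≤ h := by
    rw [hS, polyHeight_mul hM.ne_zero hS0] at hh
    omega
  set m := (M.coeff s.2).coeff s.1 with hm
  set q := (P.coeff s.2).coeff s.1 with hq
  set D : k[X][X] := Polynomial.C (Polynomial.C m) * P - Polynomial.C (Polynomial.C q) * M with hD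
  have hcoeff : ∀ i j, (D.coeff j).coeff i =
      m * (P.coeff j).coeff i - q * (M.coeff j).coeff i := by
    intro i j
    simp [hD]
  have hDbox : D = boxPoly fun p : Fin (h + 1) × Fin (d + 1) => (D.coeff p.2).coeff p.1 := by
    apply eq_boxPoly
    intro i j hij
    rw [hcoeff, natDegree_le_and_polyHeight_le_iff.1 ⟨hd, hh⟩ i j hij,
      natDegree_le_and_polyHeight_le_iff.1 ⟨hMd, hMh⟩ i j hij, mul_zero, mul_zero, sub_zero]
  have hR := H (fun p => (D.coeff p.2).coeff p.1) (by rw [hcoeff]; ring)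
    (by rw [← hDbox, hD, map_sub, map_mul, map_mul, hf, hfM, mul_zero, mul_zero, sub_zero])
  have hD0 : D = 0 := by
    rw [hDbox, hR]
    simp [boxPoly]
  have hMP : Polynomial.C (Polynomial.C m) * P = Polynomial.C (Polynomial.C q) * M :=
    sub_eq_zero.1 hD0
  have hm0 : m ≠ 0 := by
    intro hm0
    rw [hm0, map_zero, map_zero, zero_mul] at hMP
    exact mul_ne_zero (by simpa using hs) hM.ne_zero hMP.symm
  rw [← irreducible_C_C_mul hm0, hMP, irreducible_C_C_mul hs]
  exact hM

/-- A relation is irreducible iff all relations in the smallest box containing it are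
proportional to it. -/
theorem irreducible_iff_exists_rigidAt {f : k⟦X⟧} {P : k[X][X]}
    (hf : Polynomial.aeval (R := k[X]) f P = 0) (hd : P.natDegree ≤ d) (hh : polyHeight P ≤ h) :
    Irreducible P ↔ ∃ (d' : Fin (d + 1)) (h' : Fin (h + 1))
      (s : Fin ((h' : ℕ) + 1) × Fin ((d' : ℕ) + 1)),
      (P.natDegree ≤ d' ∧ polyHeight P ≤ h') ∧ (P.coeff s.2).coeff s.1 ≠ 0 ∧ RigidAt f s := by
  constructor
  · intro hP
    have hs : ∃ s : Fin (polyHeight P + 1) × Fin (P.natDegree + 1),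
        (P.coeff s.2).coeff s.1 ≠ 0 := by
      by_contra! hcon
      apply hP.ne_zero
      rw [eq_boxPoly (natDegree_le_and_polyHeight_le_iff.1 ⟨le_refl P.natDegree, le_rfl⟩)]
      simp [boxPoly, hcon]
    obtain ⟨s, hs⟩ := hs
    exact ⟨⟨P.natDegree, by omega⟩, ⟨polyHeight P, by omega⟩, s, ⟨le_rfl, le_rfl⟩, hs,
      Irreducible.rigidAt hP hf rfl rfl hs⟩
  · rintro ⟨d', h', s, ⟨h1, h2⟩, hs, H⟩
    exact H.irreducible hf h1 h2 hs

end Box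

/-! ### Constructibility of the images of the strata -/

section StratumConstructible

variable {k : Type*} [Field k] {d h e : ℕ}

/-- The polynomial `x^(e(d-2)) P`, where `P` is the normalized minimal polynomial of the point of
the stratum with coordinates `v`. -/
def chartPoly {A : Type*} [CommRing A] (v : ChartIndex d h e → A) : A[X][X] :=
  pushLine d (v ∘ Sum.inl) (normalPoly (v ∘ Sum.inr))

theorem map_chartPoly {A B : Type*} [CommRing A] [CommRing B] (φ : A →+* B)
    (v : ChartIndex d h e → A) :
    (chartPoly v).map (Polynomial.mapRingHom φ) = chartPoly (φ ∘ v) := by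
  rw [chartPoly, map_pushLine, map_normalPoly]
  rfl

theorem chartPoly_eq_iff {A : Type*} [CommRing A] [IsDomain A] (hd : 1 ≤ d)
    (hde : 2 ≤ d ∨ e = 0) {v : ChartIndex d h e → A} {P : A[X][X]} :
    chartPoly v = Polynomial.C (Polynomial.X ^ (e * (d - 2))) * P ↔
      P.comp (line (v ∘ Sum.inl)) =
        Polynomial.C (Polynomial.X ^ (2 * e)) * normalPoly (v ∘ Sum.inr) := by
  have h1 : e * d = e * (d - 2) + 2 * e := by
    rcases hde with h2 | h2
    · obtain ⟨m, rfl⟩ := Nat.exists_eq_add_of_le h2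
      rw [Nat.add_sub_cancel_left]
      ring
    · simp [h2]
  have hX : (Polynomial.C (Polynomial.X ^ (e * (d - 2))) : A[X][X]) ≠ 0 :=
    Polynomial.C_ne_zero.2 (pow_ne_zero _ Polynomial.X_ne_zero)
  rw [← (comp_line_injective (v ∘ Sum.inl)).eq_iff]
  rw [chartPoly, pushLine_comp_line _ (natDegree_normalPoly_le hd _), Polynomial.mul_comp,
    Polynomial.C_comp, h1, pow_add, map_mul, mul_assoc, mul_right_inj' hX]
  exact eq_comm

theorem mem_stratumImage_iff_chartPoly (hd : 1 ≤ d) (hde : 2 ≤ d ∨ e = 0)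
    {v : ChartIndex d h e → k} :
    v ∈ stratumImage k d h e ↔ ∃ P : k[X][X],
      chartPoly v = Polynomial.C (Polynomial.X ^ (e * (d - 2))) * P ∧
      (P.natDegree ≤ d ∧ polyHeight P ≤ h) ∧ Irreducible P := by
  rw [mem_stratumImage_iff]
  refine exists_congr fun P => ?_
  rw [chartPoly_eq_iff hd hde]
  tauto

theorem stratumImage_eq_empty (hde : ¬ (1 ≤ d ∧ (2 ≤ d ∨ e = 0))) :
    stratumImage k d h e = ∅ := by
  rw [stratumImage, Set.image_eq_empty, Set.eq_empty_iff_forall_notMem]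
  intro f hf
  obtain ⟨h1, h2, -⟩ := exists_equation_of_mem_stratum hf
  exact hde ⟨h1, h2⟩

variable (k d h e) in
/-- The generic point of the ambient affine space of the chart. -/
def genericPoint : ChartIndex d h e → MvPolynomial (ChartIndex d h e) k := MvPolynomial.X

theorem eval_comp_genericPoint (v : ChartIndex d h e → k) :
    MvPolynomial.eval v ∘ genericPoint k d h e = v := by
  funext t
  simp [genericPoint]

theorem eval_coeff_coeff_chartPoly (v : ChartIndex d h e → k) (i j : ℕ) :
    MvPolynomial.eval v (((chartPoly (genericPoint k d h e)).coeff j).coeff i) =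
      ((chartPoly v).coeff j).coeff i := by
  have := map_chartPoly (MvPolynomial.eval v) (genericPoint k d h e)
  rw [eval_comp_genericPoint] at this
  rw [← this, Polynomial.coeff_map, Polynomial.coe_mapRingHom, Polynomial.coeff_map]

theorem eval_coeff_chartSeries (v : ChartIndex d h e → k) (i j n : ℕ) :
    MvPolynomial.eval v
      (PowerSeries.coeff n (PowerSeries.X ^ i * chartSeries (genericPoint k d h e) ^ j)) =
      PowerSeries.coeff n (PowerSeries.X ^ i * chartSeries v ^ j) := by
  have := map_chartSeries (MvPolynomial.eval v) (genericPoint k d h e)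
  rw [eval_comp_genericPoint] at this
  rw [← this, ← PowerSeries.coeff_map, map_mul, map_pow, map_pow, PowerSeries.map_X]

variable (k) in
/-- The rows of the linear system `R_s = 0`, `R(x, f) = 0` for the point `f` with generic
coordinates. -/
def relationRows (d h e : ℕ) {d' h' : ℕ} (s : Fin (h' + 1) × Fin (d' + 1)) :
    Option ℕ → Fin (h' + 1) × Fin (d' + 1) → MvPolynomial (ChartIndex d h e) k
  | none => Pi.single s 1
  | some n => fun p => PowerSeries.coeff n
      (PowerSeries.X ^ (p.1 : ℕ) * chartSeries (genericPoint k d h e) ^ (p.2 : ℕ))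

theorem rigidAt_chartSeries_iff (v : ChartIndex d h e → k) {d' h' : ℕ}
    (s : Fin (h' + 1) × Fin (d' + 1)) :
    RigidAt (chartSeries v) s ↔ ∀ R : Fin (h' + 1) × Fin (d' + 1) → k,
      (∀ n, ∑ p, R p * MvPolynomial.eval v (relationRows k d h e s n p) = 0) → R = 0 := by
  refine forall_congr' fun R => ?_
  rw [Option.forall]
  have h1 : ∑ p, R p * MvPolynomial.eval v (relationRows k d h e s none p) = R s := by
    rw [Finset.sum_eq_single s]
    · simp [relationRows]
    · intro p _ hp
      simp [relationRows, hp]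
    · simp
  have h2 : (∀ n : ℕ, ∑ p, R p * MvPolynomial.eval v (relationRows k d h e s (some n) p) = 0) ↔
      Polynomial.aeval (R := k[X]) (chartSeries v) (boxPoly R) = 0 := by
    rw [PowerSeries.ext_iff]
    refine forall_congr' fun n => ?_
    rw [coeff_aeval_boxPoly, map_zero]
    simp only [relationRows, eval_coeff_chartSeries]
  rw [h1, h2, and_imp]

theorem isConstructibleSet_coeff_eq_zero (p : ℕ → ℕ → Prop) :
    IsConstructibleSet {v : ChartIndex d h e → k |
      ∀ i j, p i j → ((chartPoly v).coeff j).coeff i = 0} := by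
  convert isConstructibleSet_forall {q : MvPolynomial (ChartIndex d h e) k |
    ∃ i j, p i j ∧ ((chartPoly (genericPoint k d h e)).coeff j).coeff i = q} using 1
  ext v
  simp only [Set.mem_ofPred_eq, ← eval_coeff_coeff_chartPoly]
  constructor
  · rintro H _ ⟨i, j, hij, rfl⟩
    exact H i j hij
  · exact fun H i j hij => H _ ⟨i, j, hij, rfl⟩

theorem C_X_pow_mul_coeff (m : ℕ) (P : k[X][X]) (i j : ℕ) :
    ((Polynomial.C (Polynomial.X ^ m) * P).coeff j).coeff (i + m) = (P.coeff j).coeff i := by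
  rw [Polynomial.coeff_C_mul, Polynomial.coeff_X_pow_mul]

/-- Constructibility of the image of a stratum. No elimination is needed, because the point and
its minimal polynomial are polynomial functions of the coordinates. -/
theorem isConstructibleSet_stratumImage (d h e : ℕ) :
    IsConstructibleSet (stratumImage k d h e) := by
  by_cases hde : 1 ≤ d ∧ (2 ≤ d ∨ e = 0)
  swap
  · rw [stratumImage_eq_empty hde]
    exact isConstructibleSet_empty
  obtain ⟨hd, hde⟩ := hde
  set m := e * (d - 2) with hm
  have hset : stratumImage k d h e =
      {v | ∀ i j, i < m ∨ h + m < i → ((chartPoly v).coeff j).coeff i = 0} ∩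
      ⋃ (d' : Fin (d + 1)), ⋃ (h' : Fin (h + 1)),
        ⋃ (s : Fin ((h' : ℕ) + 1) × Fin ((d' : ℕ) + 1)),
        ({v | ∀ i j : ℕ, h' + m < i ∨ d' < j → ((chartPoly v).coeff j).coeff i = 0} ∩
          ({v | ∀ i j : ℕ, i = s.1 + m ∧ j = s.2 → ((chartPoly v).coeff j).coeff i = 0}ᶜ ∩
          {v | RigidAt (chartSeries v) s})) := by
    ext v
    rw [mem_stratumImage_iff_chartPoly hd hde]
    simp only [Set.mem_inter_iff, Set.mem_iUnion, Set.mem_ofPred_eq, Set.mem_compl_iff]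
    have key : ∀ P : k[X][X], chartPoly v = Polynomial.C (Polynomial.X ^ m) * P →
        ∀ (d' h' : ℕ), (P.natDegree ≤ d' ∧ polyHeight P ≤ h') ↔
          ∀ i j, h' + m < i ∨ d' < j → ((chartPoly v).coeff j).coeff i = 0 := by
      intro P hP d' h'
      rw [natDegree_le_and_polyHeight_le_iff]
      constructor
      · intro H i j hij
        rw [hP]
        by_cases hi : m ≤ i
        · obtain ⟨i', rfl⟩ := Nat.exists_eq_add_of_le' hi
          rw [C_X_pow_mul_coeff]
          exact H i' j (by omega)
        · rw [Polynomial.coeff_C_mul, Polynomial.coeff_X_pow_mul', if_neg hi]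
      · intro H i j hij
        rw [← C_X_pow_mul_coeff m, ← hP]
        exact H (i + m) j (by omega)
    have key2 : ∀ P : k[X][X], chartPoly v = Polynomial.C (Polynomial.X ^ m) * P →
        ∀ (i' j' : ℕ), (P.coeff j').coeff i' ≠ 0 ↔
          ¬ ∀ i j, i = i' + m ∧ j = j' → ((chartPoly v).coeff j).coeff i = 0 := by
      intro P hP i' j'
      rw [not_iff_not, ← C_X_pow_mul_coeff m, ← hP]
      constructor
      · rintro H i j ⟨rfl, rfl⟩
        exact H
      · exact fun H => H _ _ ⟨rfl, rfl⟩
    have hroot : ∀ P : k[X][X], chartPoly v = Polynomial.C (Polynomial.X ^ m) * P →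
        Polynomial.aeval (R := k[X]) (chartSeries v) P = 0 := fun P hP =>
      aeval_chartSeries ((chartPoly_eq_iff hd hde).1 hP)
    constructor
    · rintro ⟨P, hP, hbd, hirr⟩
      refine ⟨fun i j hij => ?_, ?_⟩
      · rcases hij with hi | hi
        · rw [hP, Polynomial.coeff_C_mul, Polynomial.coeff_X_pow_mul', if_neg (by omega)]
        · exact (key P hP d h).1 hbd i j (Or.inl hi)
      · obtain ⟨d', h', s, h1, h2, h3⟩ :=
          (irreducible_iff_exists_rigidAt (hroot P hP) hbd.1 hbd.2).1 hirr
        exact ⟨d', h', s, (key P hP _ _).1 h1, (key2 P hP _ _).1 h2, h3⟩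
    · rintro ⟨H, d', h', s, h1, h2, h3⟩
      have hdvd : Polynomial.C (Polynomial.X ^ m) ∣ chartPoly v := by
        rw [Polynomial.C_dvd_iff_dvd_coeff]
        intro j
        rw [Polynomial.X_pow_dvd_iff]
        exact fun i hi => H i j (Or.inl hi)
      obtain ⟨P, hP⟩ := hdvd
      have hbd : P.natDegree ≤ d ∧ polyHeight P ≤ h := by
        have := (key P hP d' h').2 h1
        exact ⟨this.1.trans (Nat.lt_succ_iff.1 d'.2), this.2.trans (Nat.lt_succ_iff.1 h'.2)⟩
      exact ⟨P, hP, hbd, (irreducible_iff_exists_rigidAt (hroot P hP) hbd.1 hbd.2).2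
        ⟨d', h', s, (key P hP _ _).2 h1, (key2 P hP _ _).2 h2, h3⟩⟩
  rw [hset]
  refine (isConstructibleSet_coeff_eq_zero _).inter (isConstructibleSet_iUnion fun d' =>
    isConstructibleSet_iUnion fun h' => isConstructibleSet_iUnion fun s => ?_)
  refine (isConstructibleSet_coeff_eq_zero _).inter
    ((isConstructibleSet_coeff_eq_zero _).compl.inter ?_)
  simp only [rigidAt_chartSeries_iff]
  exact isConstructibleSet_injective _

end StratumConstructible

/-! ### Krull dimension and algebraic dependence -/

section Dimension

open Cardinal in
/-- The Krull dimension of an affine domain is at most the number of elements over which it is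
algebraic. -/
theorem ringKrullDim_le_of_isAlgebraic {k B : Type*} [Field k] [CommRing B] [IsDomain B]
    [Algebra k B] [Algebra.FiniteType k B] {n : ℕ} (x : Fin n → B)
    [Algebra.IsAlgebraic (Algebra.adjoin k (Set.range x)) B] : ringKrullDim B ≤ n := by
  obtain ⟨s, g, hg, hint⟩ := exists_integral_inj_algHom_of_fg k B
  have hind : AlgebraicIndependent k fun i => g (MvPolynomial.X i) := by
    have h1 : MvPolynomial.aeval (fun i => g (MvPolynomial.X i)) = g := by
      ext i
      simp
    rw [AlgebraicIndependent, h1]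
    exact hg
  have hs : s ≤ n := by
    have h1 := hind.lift_cardinalMk_le_trdeg
    have h2 := Algebra.IsAlgebraic.trdeg_le_cardinalMk k (Set.range x)
    have h3 : Cardinal.mk (Set.range x) ≤ n := by
      have := Cardinal.mk_range_le_lift (f := x)
      simpa using this
    have h4 := (Cardinal.lift_le.1 ((h1.trans (Cardinal.lift_le.2 (h2.trans h3))).trans_eq
      (by simp : _ = Cardinal.lift (n : Cardinal))))
    simpa using h4
  have hdim : ringKrullDim B ≤ ringKrullDim (MvPolynomial (Fin s) k) := by
    algebraize [g.toRingHom]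
    have : Algebra.IsIntegral (MvPolynomial (Fin s) k) B := ⟨hint⟩
    refine Order.krullDim_le_of_strictMono
      (PrimeSpectrum.comap (algebraMap (MvPolynomial (Fin s) k) B)) ?_
    intro p q hpq
    exact Ideal.IsIntegral.comap_lt_comap (R := MvPolynomial (Fin s) k) hpq
  refine hdim.trans ?_
  rw [MvPolynomial.ringKrullDim_of_isNoetherianRing, ringKrullDim_eq_zero_of_field, zero_add]
  simpa using hs

theorem ringKrullDim_quotient_le_of_forall_isPrime {R : Type*} [CommRing R] {I : Ideal R}
    {n : WithBot ℕ∞} (H : ∀ p : Ideal R, p.IsPrime → I ≤ p → ringKrullDim (R ⧸ p) ≤ n) :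
    ringKrullDim (R ⧸ I) ≤ n := by
  rw [ringKrullDim_quotient, Order.krullDim]
  refine iSup_le fun l => ?_
  have h1 := H l.head.1.asIdeal l.head.1.isPrime l.head.2
  rw [ringKrullDim_quotient] at h1
  refine le_trans ?_ h1
  let l' : LTSeries (PrimeSpectrum.zeroLocus (R := R) l.head.1.asIdeal) :=
    { length := l.length
      toFun := fun i => ⟨(l i).1, l.head_le i⟩
      step := fun i => l.step i }
  exact le_iSup (fun p : LTSeries (PrimeSpectrum.zeroLocus (R := R) l.head.1.asIdeal) =>
    (p.length : WithBot ℕ∞)) l'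

/-- The coefficients of a power series that is a root of a polynomial over `L[x]` are algebraic
over `L`: after division by a power of `x` the equation specializes at `x = 0` to an equation for
the constant coefficient, and one continues with `T ↦ f(0) + x T`. -/
theorem coeff_mem_range_of_aeval_eq_zero {L B : Type*} [CommRing L] [IsDomain L] [CommRing B]
    [IsDomain B] [Algebra L B]
    (hL : ∀ y : B, IsAlgebraic L y → y ∈ Set.range (algebraMap L B)) (n : ℕ) :
    ∀ (P : L[X][X]) (f : B⟦X⟧), P ≠ 0 →
      Polynomial.aeval (R := B[X]) f (P.map (Polynomial.mapRingHom (algebraMap L B))) = 0 →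
      PowerSeries.coeff n f ∈ Set.range (algebraMap L B) := by
  have hconst : ∀ (P : L[X][X]) (f : B⟦X⟧), P ≠ 0 →
      Polynomial.aeval (R := B[X]) f (P.map (Polynomial.mapRingHom (algebraMap L B))) = 0 →
      PowerSeries.constantCoeff f ∈ Set.range (algebraMap L B) := by
    intro P f hP hf
    obtain ⟨q, hq, hq0⟩ := Polynomial.exists_eq_pow_rootMultiplicity_mul_and_not_dvd
      (Bivariate.swap P) (by simpa using hP) 0
    set N := (Bivariate.swap P).rootMultiplicity 0
    rw [Polynomial.C_0, sub_zero] at hq hq0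
    have hPq : P = Polynomial.C (Polynomial.X ^ N) * Bivariate.swap q := by
      rw [← Bivariate.swap_swap_apply P, hq, map_mul, map_pow, Bivariate.swap_Y, map_pow]
    rw [hPq, Polynomial.map_mul, Polynomial.map_C, map_mul, aeval_C_series,
      Polynomial.coe_mapRingHom, Polynomial.map_pow, Polynomial.map_X, coe_X_pow] at hf
    have hf' := (mul_eq_zero.1 hf).resolve_left (pow_ne_zero _ PowerSeries.X_ne_zero)
    have hf'' := congrArg PowerSeries.constantCoeff hf'
    rw [constantCoeff_aeval, map_zero] at hf''
    apply hL
    refine ⟨q.coeff 0, fun h0 => hq0 (Polynomial.X_dvd_iff.2 h0), ?_⟩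
    rw [← hf'', ← Polynomial.eval_map_algebraMap]
    congr 1
    ext j
    rw [coeff_coeff_swap, Polynomial.coeff_map, Polynomial.coeff_map, Polynomial.coe_mapRingHom,
      Polynomial.coeff_map, coeff_coeff_swap]
  induction n with
  | zero =>
    intro P f hP hf
    rw [PowerSeries.coeff_zero_eq_constantCoeff_apply]
    exact hconst P f hP hf
  | succ n ih =>
    intro P f hP hf
    obtain ⟨l, hl⟩ := hconst P f hP hf
    obtain ⟨g, hg⟩ := PowerSeries.X_dvd_iff.2
      (show PowerSeries.constantCoeff (f - PowerSeries.C (algebraMap L B l)) = 0 by simp [hl])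
    have hfg : f = PowerSeries.C (algebraMap L B l) + PowerSeries.X * g := by
      rw [← hg, add_sub_cancel]
    let ℓ : L[X][X] := Polynomial.C (Polynomial.C l) + Polynomial.C Polynomial.X * Polynomial.X
    have hℓ : ℓ.natDegree = 1 := by
      rw [show ℓ = Polynomial.C Polynomial.X * Polynomial.X + Polynomial.C (Polynomial.C l) from
        add_comm _ _, Polynomial.natDegree_add_C,
        Polynomial.natDegree_C_mul_X _ Polynomial.X_ne_zero]
    have := ih (P.comp ℓ) g ?_ ?_
    · rwa [hfg, map_add, PowerSeries.coeff_succ_X_mul, PowerSeries.coeff_C,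
        if_neg (Nat.succ_ne_zero n), zero_add]
    · intro h0
      rcases Polynomial.comp_eq_zero_iff.1 h0 with h1 | ⟨-, h1⟩
      · exact hP h1
      · have h2 := congrArg Polynomial.natDegree h1
        rw [hℓ, Polynomial.natDegree_C] at h2
        omega
    · rw [Polynomial.map_comp, Polynomial.aeval_comp]
      have h1 : Polynomial.aeval (R := B[X]) g
          (ℓ.map (Polynomial.mapRingHom (algebraMap L B))) = f := by
        rw [hfg]
        simp only [ℓ, Polynomial.map_add, Polynomial.map_mul, Polynomial.map_C, Polynomial.map_X,
          map_add, map_mul, aeval_C_series, Polynomial.aeval_X, Polynomial.coe_mapRingHom,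
          Polynomial.coe_C, Polynomial.coe_X]
      rw [h1]
      exact hf

end Dimension

/-! ### The dimension of the strata -/

section UpperBound

variable {k : Type*} [Field k] {d h e : ℕ}

theorem coeff_chartSeries {A : Type*} [CommRing A] (v : ChartIndex d h e → A) (i : Fin e) :
    PowerSeries.coeff ((i : ℕ) + 1) (chartSeries v) = v (Sum.inl i) := by
  rw [chartSeries, map_add, Polynomial.coeff_coe, coeff_headPoly, PowerSeries.coeff_X_pow_mul']
  split_ifs with h1
  · have h2 : (i : ℕ) + 1 - e = 0 := by have := i.2; omega
    rw [h2, PowerSeries.coeff_zero_eq_constantCoeff_apply, constantCoeff_branch, add_zero]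
    rfl
  · rw [add_zero]
    rfl

theorem exists_map_mapRingHom_eq {A B : Type*} [CommRing A] [CommRing B] (φ : A →+* B)
    {P : B[X][X]} (hP : ∀ i j, (P.coeff j).coeff i ∈ Set.range φ) :
    ∃ P' : A[X][X], P'.map (Polynomial.mapRingHom φ) = P := by
  have h1 : P ∈ Polynomial.lifts (Polynomial.mapRingHom φ) := by
    rw [Polynomial.lifts_iff_coeff_lifts]
    intro j
    have h2 : P.coeff j ∈ Polynomial.lifts φ := by
      rw [Polynomial.lifts_iff_coeff_lifts]
      exact fun i => hP i j
    exact (Polynomial.mem_lifts _).1 h2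
  exact (Polynomial.mem_lifts _).1 h1

/-- Let `v` be a point of the ambient space of the chart, with values in a domain `B`, such that
`chartPoly v = x^(e(d-2)) P` with `P` of degree at most `d` and height at most `h`. If `e ≥ 1`, then
`P` has no terms `x^0 T^0` and `x^0 T^1`, and all coordinates of `v` are algebraic over the other
coefficients of `P`. -/
theorem isAlgebraic_coordinates {B : Type*} [CommRing B] [IsDomain B] (hd : 1 ≤ d)
    (hde : 2 ≤ d ∨ e = 0) (he : e ≠ 0) {v : ChartIndex d h e → B} {P : B[X][X]}
    (hvP : chartPoly v = Polynomial.C (Polynomial.X ^ (e * (d - 2))) * P)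
    (hP : ∀ i j, h < i ∨ d < j → (P.coeff j).coeff i = 0)
    (S : Subring B) (hS : ∀ p : CoeffIndex d h, (P.coeff p.1.2).coeff p.1.1 ∈ S)
    (hSalg : ∀ y : B, IsAlgebraic S y → y ∈ S) (t : ChartIndex d h e) : v t ∈ S := by
  have hcomp := (chartPoly_eq_iff hd hde).1 hvP
  have hroot := aeval_chartSeries hcomp
  have hconst : PowerSeries.constantCoeff (chartSeries v) = 0 := by
    rw [chartSeries, map_add, map_mul, constantCoeff_branch, mul_zero, add_zero,
      ← PowerSeries.coeff_zero_eq_constantCoeff_apply, Polynomial.coeff_coe, coeff_zero_headPoly]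
  have hrange : Set.range (algebraMap S B) = (S : Set B) := Subtype.range_coe
  have hP00 : (P.coeff 0).coeff 0 = 0 := by
    rw [← constantCoeff_aeval_of_constantCoeff_eq_zero hconst, hroot, map_zero]
  have hP01 : (P.coeff 1).coeff 0 = 0 := by
    have h1 := congrArg derivative hcomp
    rw [derivative_comp_line, Polynomial.derivative_C_mul, two_mul, pow_add, map_mul,
      mul_assoc] at h1
    have h2 := mul_left_cancel₀
      (Polynomial.C_ne_zero.2 (pow_ne_zero _ Polynomial.X_ne_zero)) h1
    have h3 := congrArg (fun Q => PowerSeries.constantCoeff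
      (Polynomial.aeval (R := B[X]) (branch (v ∘ Sum.inr)) Q)) h2
    beta_reduce at h3
    rw [aeval_comp_line, map_mul, aeval_C_series, map_mul, coe_X_pow, map_pow,
      PowerSeries.constantCoeff_X, zero_pow he, zero_mul] at h3
    rw [← coeff_derivative_zero_zero, ← constantCoeff_aeval_of_constantCoeff_eq_zero hconst]
    exact h3
  have hPmem : ∀ i j, (P.coeff j).coeff i ∈ Set.range (algebraMap S B) := by
    intro i j
    rw [hrange]
    by_cases hij : h < i ∨ d < j
    · rw [hP i j hij]
      exact S.zero_mem
    · by_cases h0 : i ≠ 0 ∨ 2 ≤ j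
      · exact hS ⟨(⟨i, by omega⟩, ⟨j, by omega⟩), h0⟩
      · obtain ⟨rfl, hj⟩ : i = 0 ∧ (j = 0 ∨ j = 1) := by omega
        rcases hj with rfl | rfl
        · rw [hP00]
          exact S.zero_mem
        · rw [hP01]
          exact S.zero_mem
  obtain ⟨P', hP'⟩ := exists_map_mapRingHom_eq (algebraMap S B) hPmem
  have hP0 : P' ≠ 0 := by
    rintro rfl
    rw [← hP', Polynomial.map_zero, Polynomial.zero_comp] at hcomp
    have h1 := (mul_eq_zero.1 hcomp.symm).resolve_left
      (Polynomial.C_ne_zero.2 (pow_ne_zero _ Polynomial.X_ne_zero))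
    have h2 := normalPoly_coeff_one_coeff_zero (v ∘ Sum.inr)
    rw [h1] at h2
    simp at h2
  have hcoeff : ∀ n, PowerSeries.coeff n (chartSeries v) ∈ Set.range (algebraMap S B) := fun n =>
    coeff_mem_range_of_aeval_eq_zero (by rw [hrange]; exact hSalg) n P' _ hP0
      (by rw [hP']; exact hroot)
  have ha : ∀ i : Fin e, ∃ b : S, algebraMap S B b = v (Sum.inl i) := by
    intro i
    rw [← coeff_chartSeries v i]
    exact hcoeff _
  rcases t with i | p
  · rw [← SetLike.mem_coe, ← hrange]
    exact ha i
  · choose b hb using ha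
    have hline : (line b).map (Polynomial.mapRingHom (algebraMap S B)) = line (v ∘ Sum.inl) := by
      have hb' : (algebraMap S B) ∘ b = v ∘ Sum.inl := funext hb
      rw [line, line, ← hb', ← map_headPoly]
      simp
    have h1 : ((P.comp (line (v ∘ Sum.inl))).coeff (p.1.2 : ℕ)).coeff ((p.1.1 : ℕ) + 2 * e) =
        v (Sum.inr p) := by
      rw [hcomp, Polynomial.coeff_C_mul, Polynomial.coeff_X_pow_mul, coeff_coeff_normalPoly]
      rfl
    rw [← h1, ← hP', ← hline, ← Polynomial.map_comp, Polynomial.coeff_map,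
      Polynomial.coe_mapRingHom, Polynomial.coeff_map]
    exact Subtype.coe_prop _

theorem C_X_pow_dvd_chartPoly {B : Type*} [CommRing B] {v : ChartIndex d h e → B} {m : ℕ}
    (hv : ∀ i j, i < m ∨ h + m < i → ((chartPoly v).coeff j).coeff i = 0) :
    ∃ P : B[X][X], chartPoly v = Polynomial.C (Polynomial.X ^ m) * P ∧
      ∀ i j, h < i ∨ d < j → (P.coeff j).coeff i = 0 := by
  have hdvd : Polynomial.C (Polynomial.X ^ m) ∣ chartPoly v := by
    rw [Polynomial.C_dvd_iff_dvd_coeff]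
    intro j
    rw [Polynomial.X_pow_dvd_iff]
    exact fun i hi => hv i j (Or.inl hi)
  obtain ⟨P, hP⟩ := hdvd
  refine ⟨P, hP, fun i j hij => ?_⟩
  have h1 : (P.coeff j).coeff i = ((chartPoly v).coeff j).coeff (i + m) := by
    rw [hP, Polynomial.coeff_C_mul, Polynomial.coeff_X_pow_mul]
  rw [h1]
  rcases hij with hi | hj
  · exact hv _ _ (Or.inr (by omega))
  · have h2 : (chartPoly v).coeff j = 0 :=
      Polynomial.coeff_eq_zero_of_natDegree_lt ((natDegree_pushLine_le d _ _).trans_lt hj)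
    rw [h2, Polynomial.coeff_zero]

theorem coeff_coeff_chartPoly_eq_zero {v : ChartIndex d h e → k} (hv : v ∈ stratumImage k d h e)
    {i j : ℕ} (hij : i < e * (d - 2) ∨ h + e * (d - 2) < i) :
    ((chartPoly v).coeff j).coeff i = 0 := by
  have hde : 1 ≤ d ∧ (2 ≤ d ∨ e = 0) := by
    by_contra hcon
    rw [stratumImage_eq_empty hcon] at hv
    exact hv
  obtain ⟨P, hP, ⟨-, hh⟩, -⟩ := (mem_stratumImage_iff_chartPoly hde.1 hde.2).1 hv
  rw [hP, Polynomial.coeff_C_mul, Polynomial.coeff_X_pow_mul']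
  split_ifs with h1
  · exact polyHeight_le_iff_coeff.1 hh _ _ (by omega)
  · rfl

/-- A subset of the domain `B` spans an algebraic extension if its algebraic closure contains
generators of `B`. -/
theorem isAlgebraic_adjoin_of_generators {B τ : Type*} [CommRing B] [IsDomain B] [Algebra k B]
    {φ : MvPolynomial τ k →ₐ[k] B} (hφ : Function.Surjective φ) (s : Set B)
    (H : ∀ S : Subring B, s ⊆ S → (∀ y : B, IsAlgebraic S y → y ∈ S) →
      ∀ t, φ (MvPolynomial.X t) ∈ S) :
    Algebra.IsAlgebraic (Algebra.adjoin k s) B := by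
  let L := Subalgebra.algebraicClosure (Algebra.adjoin k s) B
  have hsL : s ⊆ L.toSubring := by
    intro y hy
    exact isAlgebraic_algebraMap (⟨y, Algebra.subset_adjoin hy⟩ : Algebra.adjoin k s)
  have hL : ∀ y : B, IsAlgebraic L.toSubring y → y ∈ L.toSubring := by
    intro y hy
    have hy' : IsAlgebraic L y := hy
    exact hy'.restrictScalars (Algebra.adjoin k s)
  have hgen := H L.toSubring hsL hL
  constructor
  intro b
  obtain ⟨G, rfl⟩ := hφ b
  change φ G ∈ L
  induction G using MvPolynomial.induction_on with
  | C a =>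
    rw [← MvPolynomial.algebraMap_eq, AlgHom.commutes]
    exact L.algebraMap_mem (algebraMap k (Algebra.adjoin k s) a)
  | add p q hp hq =>
    rw [map_add]
    exact L.add_mem hp hq
  | mul_X p t hp =>
    rw [map_mul]
    exact L.mul_mem hp (hgen t)

/-- The closure of the image of a stratum has dimension at most `dh + d + h - 1`. -/
theorem ringKrullDim_le_of_vanishing {B : Type*} [CommRing B] [IsDomain B] [Algebra k B]
    (hd : 1 ≤ d) {φ : MvPolynomial (ChartIndex d h e) k →ₐ[k] B} (hφ : Function.Surjective φ)
    (hvan : ∀ G : MvPolynomial (ChartIndex d h e) k,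
      (∀ v ∈ stratumImage k d h e, MvPolynomial.eval v G = 0) → φ G = 0) :
    ringKrullDim B ≤ ((d * h + d + h - 1 : ℕ) : WithBot ℕ∞) := by
  have : Algebra.FiniteType k B := Algebra.FiniteType.of_surjective φ hφ
  have hB : ∀ x : CoeffIndex d h → B, (∀ S : Subring B, Set.range x ⊆ S →
      (∀ y : B, IsAlgebraic S y → y ∈ S) → ∀ t, φ (MvPolynomial.X t) ∈ S) →
      ringKrullDim B ≤ ((d * h + d + h - 1 : ℕ) : WithBot ℕ∞) := by
    intro x hx
    let E := Fintype.equivFinOfCardEq (card_coeffIndex d h hd)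
    have hr : Set.range (x ∘ E.symm) = Set.range x := E.symm.surjective.range_comp x
    have : Algebra.IsAlgebraic (Algebra.adjoin k (Set.range (x ∘ E.symm))) B := by
      rw [hr]
      exact isAlgebraic_adjoin_of_generators hφ _ hx
    exact ringKrullDim_le_of_isAlgebraic (k := k) (x ∘ E.symm)
  by_cases he : e = 0
  · subst he
    let c : CoeffIndex d h → CoeffIndex d (h + 0 * (d - 2)) := fun p =>
      ⟨(⟨p.1.1, by have := p.1.1.2; omega⟩, p.1.2), p.2⟩
    refine hB (fun p => φ (MvPolynomial.X (Sum.inr (c p)))) ?_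
    rintro S hS - (i | p)
    · exact i.elim0
    -- `c` is onto, since the height bound of the chart is `h` for `e = 0`
    · exact hS ⟨⟨(⟨p.1.1, by have := p.1.1.2; omega⟩, p.1.2), p.2⟩, rfl⟩
  · have hde : 2 ≤ d ∨ e = 0 := by
      by_contra hcon
      have h1 := hvan 1 (by
        rw [stratumImage_eq_empty (fun h => hcon h.2)]
        exact fun v hv => absurd hv (Set.notMem_empty v))
      rw [map_one] at h1
      exact one_ne_zero h1
    set v : ChartIndex d h e → B := φ ∘ genericPoint k d h e with hv
    have hgen : ∀ i j, ((chartPoly v).coeff j).coeff i =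
        φ (((chartPoly (genericPoint k d h e)).coeff j).coeff i) := by
      intro i j
      have := map_chartPoly (φ : MvPolynomial (ChartIndex d h e) k →+* B) (genericPoint k d h e)
      rw [hv]
      rw [show (φ ∘ genericPoint k d h e) =
        ((φ : MvPolynomial (ChartIndex d h e) k →+* B) ∘ genericPoint k d h e) from rfl,
        ← this, Polynomial.coeff_map, Polynomial.coe_mapRingHom, Polynomial.coeff_map]
      rfl
    obtain ⟨P, hP, hPbox⟩ := C_X_pow_dvd_chartPoly (v := v) (m := e * (d - 2)) (by
      intro i j hij
      rw [hgen]
      apply hvan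
      intro w hw
      rw [eval_coeff_coeff_chartPoly]
      exact coeff_coeff_chartPoly_eq_zero hw hij)
    refine hB (fun p => (P.coeff p.1.2).coeff p.1.1) ?_
    intro S hS hSalg t
    exact isAlgebraic_coordinates hd hde he hP hPbox S (fun p => hS ⟨p, rfl⟩) hSalg t

end UpperBound

/-! ### The dimension of the union -/

section UnionDimension

variable {k : Type*} [Field k] {d h : ℕ}

theorem aeval_affinePoly_eval {σ τ : Type*} [Fintype σ] [DecidableEq σ]
    (φ : (σ → k) →ᵃ[k] (τ → k)) (v : σ → k) (G : MvPolynomial τ k) :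
    MvPolynomial.eval v (MvPolynomial.aeval (affinePoly φ) G) = MvPolynomial.eval (φ v) G := by
  rw [← MvPolynomial.coe_aeval_eq_eval, RingHom.coe_coe, ← MvPolynomial.bind₁,
    MvPolynomial.aeval_bind₁]
  simp only [MvPolynomial.aeval_eq_eval, eval_affinePoly]

theorem zariskiDim_imageUnion_le (hd : 1 ≤ d) {M : ℕ}
    (ι : (e : ℕ) → (ChartIndex d h e → k) →ᵃ[k] (Fin M → k))
    (hι : ∀ e ≤ 2 * d * h, Function.Injective (ι e)) :
    zariskiDim (imageUnion d h ι) ≤ ((d * h + d + h - 1 : ℕ) : WithBot ℕ∞) := by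
  classical
  refine ringKrullDim_quotient_le_of_forall_isPrime fun p hp hIp => ?_
  have hfin : (Finset.range (2 * d * h + 1)).inf
      (fun e => MvPolynomial.vanishingIdeal k (ι e '' stratumImage k d h e)) ≤ p := by
    refine le_trans ?_ hIp
    intro G hG
    rw [MvPolynomial.mem_vanishingIdeal_iff]
    intro w hw
    simp only [imageUnion, Set.mem_iUnion, Set.mem_Iic, exists_prop] at hw
    obtain ⟨e, he, hw⟩ := hw
    have h1 := Finset.inf_le (f := fun e => MvPolynomial.vanishingIdeal k
      (ι e '' stratumImage k d h e)) (Finset.mem_range.2 (Nat.lt_succ_of_le he)) hG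
    exact MvPolynomial.mem_vanishingIdeal_iff.1 h1 w hw
  obtain ⟨e, he, hle⟩ := (Ideal.IsPrime.inf_le' hp).1 hfin
  obtain ⟨ρ, hρ⟩ := exists_affine_leftInverse (hι e (Nat.lt_succ_iff.1 (Finset.mem_range.1 he)))
  let q := Ideal.Quotient.mkₐ k p
  let φ : MvPolynomial (ChartIndex d h e) k →ₐ[k] (MvPolynomial (Fin M) k ⧸ p) :=
    q.comp (MvPolynomial.aeval (affinePoly ρ))
  have hmem : ∀ G : MvPolynomial (Fin M) k,
      (∀ v ∈ stratumImage k d h e, MvPolynomial.eval (ι e v) G = 0) → q G = 0 := by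
    intro G hG
    refine Ideal.Quotient.eq_zero_iff_mem.2 (hle ?_)
    rw [MvPolynomial.mem_vanishingIdeal_iff]
    rintro _ ⟨v, hv, rfl⟩
    exact hG v hv
  have hφ : Function.Surjective φ := by
    have h1 : φ.comp (MvPolynomial.aeval (affinePoly (ι e))) = q := by
      apply MvPolynomial.algHom_ext
      intro t
      rw [← sub_eq_zero]
      change q (MvPolynomial.aeval (affinePoly ρ) (MvPolynomial.aeval (affinePoly (ι e))
        (MvPolynomial.X t))) - q (MvPolynomial.X t) = 0
      rw [← map_sub]
      apply hmem
      intro v _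
      rw [map_sub, aeval_affinePoly_eval, aeval_affinePoly_eval, hρ, sub_self]
    intro b
    obtain ⟨G, rfl⟩ := Ideal.Quotient.mkₐ_surjective k p b
    exact ⟨_, AlgHom.congr_fun h1 G⟩
  refine ringKrullDim_le_of_vanishing hd hφ fun G hG => hmem _ fun v hv => ?_
  change MvPolynomial.eval (ι e v) (MvPolynomial.aeval (affinePoly ρ) G) = 0
  rw [aeval_affinePoly_eval, hρ]
  exact hG v hv

/-- The polynomial `T + x^h + x^h T^d` is irreducible, by Eisenstein's criterion in `x` at the prime
`T`. -/
theorem irreducible_X_add (hd : 1 ≤ d) (hh : 1 ≤ h) :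
    Irreducible (Polynomial.X + Polynomial.C (Polynomial.X ^ h) * (1 + Polynomial.X ^ d) :
      k[X][X]) ∧
    polyHeight (Polynomial.X + Polynomial.C (Polynomial.X ^ h) * (1 + Polynomial.X ^ d) :
      k[X][X]) = h := by
  set Q : k[X][X] := Polynomial.X + Polynomial.C (Polynomial.X ^ h) * (1 + Polynomial.X ^ d)
  set r : k[X] := 1 + Polynomial.X ^ d with hr
  have hr0 : r.coeff 0 = 1 := by
    rw [hr, Polynomial.coeff_add, Polynomial.coeff_X_pow, if_neg (by omega)]
    simp
  have hrX : ¬ Polynomial.X ∣ r := by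
    rw [Polynomial.X_dvd_iff, hr0]
    exact one_ne_zero
  have hrne : r ≠ 0 := fun h0 => hrX (h0 ▸ dvd_zero _)
  have hswap : Bivariate.swap Q =
      Polynomial.C r * Polynomial.X ^ h + Polynomial.C Polynomial.X := by
    simp only [Q, hr, map_add, map_mul, map_one, map_pow, Bivariate.swap_Y, Bivariate.swap_X]
    ring
  have hdeg : (Bivariate.swap Q).natDegree = h := by
    rw [hswap, Polynomial.natDegree_add_C, Polynomial.natDegree_C_mul_X_pow h r hrne]
  have hc : ∀ n, (Bivariate.swap Q).coeff n =
      (if n = h then r else 0) + if n = 0 then Polynomial.X else 0 := by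
    intro n
    rw [hswap, Polynomial.coeff_add, Polynomial.coeff_C_mul_X_pow, Polynomial.coeff_C]
  have hc0 : (Bivariate.swap Q).coeff 0 = Polynomial.X := by
    rw [hc, if_neg (by omega), if_pos rfl, zero_add]
  have hch : (Bivariate.swap Q).coeff h = r := by
    rw [hc, if_pos rfl, if_neg (by omega), add_zero]
  refine ⟨?_, by rw [polyHeight_eq_natDegree_swap, hdeg]⟩
  rw [← MulEquiv.irreducible_iff (Bivariate.swap (R := k))]
  refine Polynomial.IsEisensteinAt.irreducible (𝓟 := Ideal.span {Polynomial.X}) ⟨?_, ?_, ?_⟩ ?_ ?_ ?_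
  · rw [Polynomial.leadingCoeff, hdeg, hch, Ideal.mem_span_singleton]
    exact hrX
  · intro n hn
    rw [hdeg] at hn
    rw [hc, if_neg (by omega), zero_add, Ideal.mem_span_singleton]
    split_ifs
    · exact dvd_rfl
    · exact dvd_zero _
  · rw [hc0, Ideal.span_singleton_pow, Ideal.mem_span_singleton, Polynomial.X_pow_dvd_iff]
    intro H
    simpa using H 1 (by norm_num)
  · exact (Ideal.span_singleton_prime Polynomial.X_ne_zero).2 Polynomial.prime_X
  · intro s hs
    rw [Polynomial.C_dvd_iff_dvd_coeff] at hs
    have h1 := hs 0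
    have h2 := hs h
    rw [hc0] at h1
    rw [hch, hr] at h2
    have h3 : s ∣ Polynomial.X ^ d := h1.trans (dvd_pow_self _ (by omega))
    exact isUnit_of_dvd_one ((dvd_add_left h3).1 h2)
  · omega

/-- Some series in the stratum `e = 0` has exact degree `d` and height `h`. -/
theorem exists_mem_stratum_zero (hd : 1 ≤ d) (hh : 1 ≤ h) :
    ∃ f ∈ stratum k d h 0, (minPoly f).natDegree = d ∧ polyHeight (minPoly f) = h := by
  obtain ⟨hirr, hheight⟩ := irreducible_X_add (k := k) hd hh
  set Q : k[X][X] := Polynomial.X + Polynomial.C (Polynomial.X ^ h) * (1 + Polynomial.X ^ d)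
    with hQ
  have hcoeff : ∀ j, Q.coeff j = (if j = 1 then 1 else 0) +
      Polynomial.X ^ h * ((if j = 0 then 1 else 0) + if j = d then 1 else 0) := by
    intro j
    rw [hQ, Polynomial.coeff_add, Polynomial.coeff_C_mul, Polynomial.coeff_add,
      Polynomial.coeff_X_pow, Polynomial.coeff_one, Polynomial.coeff_X]
    simp only [eq_comm]
  have h00 : (Q.coeff 0).coeff 0 = 0 := by
    rw [hcoeff, if_neg (by omega), zero_add, Polynomial.coeff_X_pow_mul', if_neg (by omega)]
  have h01 : ((derivative Q).coeff 0).coeff 0 = 1 := by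
    rw [coeff_derivative_zero_zero, hcoeff, if_pos rfl, Polynomial.coeff_add,
      Polynomial.coeff_X_pow_mul', if_neg (by omega), add_zero, Polynomial.coeff_one_zero]
  have hdeg : Q.natDegree = d := by
    apply le_antisymm
    · rw [Polynomial.natDegree_le_iff_coeff_eq_zero]
      intro j hj
      rw [hcoeff, if_neg (by omega), if_neg (by omega), if_neg (by omega)]
      simp
    · apply Polynomial.le_natDegree_of_ne_zero
      intro h0
      have h1 := congrArg (fun p => Polynomial.coeff p h) h0
      beta_reduce at h1
      rw [hcoeff, if_neg (by omega : ¬ d = 0), if_pos rfl, zero_add, mul_one,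
        Polynomial.coeff_add, Polynomial.coeff_X_pow_self, Polynomial.coeff_zero] at h1
      have h2 : (if d = 1 then (1 : k[X]) else 0).coeff h = 0 := by
        split_ifs
        · rw [Polynomial.coeff_one, if_neg (by omega)]
        · rw [Polynomial.coeff_zero]
      rw [h2, zero_add] at h1
      exact one_ne_zero h1
  obtain ⟨f, hf0, hf⟩ := exists_aeval_eq_zero h00 h01
  obtain ⟨u, hu, hmin⟩ := minPoly_eq_C_C_mul hirr hf
  have hd' : (minPoly f).natDegree = d := by rw [hmin, natDegree_C_C_mul hu, hdeg]
  have hh' : polyHeight (minPoly f) = h := by rw [hmin, polyHeight_C_C_mul hu, hheight]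
  refine ⟨f, ⟨⟨⟨⟨Q, hirr.ne_zero, hf⟩, hd'.le, hh'.le⟩, hf0⟩, ?_⟩, hd', hh'⟩
  refine order_eq_of_eq_X_pow_mul (by rw [pow_zero, one_mul]) ?_
  rw [constantCoeff_aeval_of_constantCoeff_eq_zero hf0, hmin, Polynomial.derivative_C_mul,
    Polynomial.coeff_C_mul, Polynomial.coeff_C_mul, h01, mul_one]
  exact hu

theorem line_of_isEmpty (a : Fin 0 → k) : line a = Polynomial.X := by
  simp [line, headPoly]

/-- The image of the stratum `e = 0` contains a nonempty open subset of the affine space. -/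
theorem exists_open_subset_stratumImage_zero (hd : 1 ≤ d) (hh : 1 ≤ h) :
    ∃ g : MvPolynomial (ChartIndex d h 0) k, g ≠ 0 ∧
      ∀ v, MvPolynomial.eval v g ≠ 0 → v ∈ stratumImage k d h 0 := by
  obtain ⟨f, hf, hdeg, hheight⟩ := exists_mem_stratum_zero (k := k) hd hh
  let s : Fin (h + 1) × Fin (d + 1) := (⟨0, by omega⟩, ⟨1, by omega⟩)
  have hs : ((minPoly f).coeff s.2).coeff s.1 ≠ 0 := by
    have := (PowerSeries.order_eq_nat.1 hf.2).1
    rwa [PowerSeries.coeff_zero_eq_constantCoeff_apply,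
      constantCoeff_aeval_of_constantCoeff_eq_zero hf.1.2, coeff_derivative_zero_zero] at this
  have hrigid : RigidAt f s := Irreducible.rigidAt (irreducible_minPoly hf.1.1.1)
    (aeval_minPoly hf.1.1.1) hdeg hheight hs
  rw [← chartSeries_chart hf, rigidAt_chartSeries_iff, forall_eq_zero_iff_exists_eval_det] at hrigid
  obtain ⟨g, hg⟩ := hrigid
  refine ⟨(Matrix.of fun i j => relationRows k d h 0 s (g i) j).det,
    fun h0 => hg (by rw [h0, map_zero]), fun v hv => ?_⟩
  have hv' := (forall_eq_zero_iff_exists_eval_det (relationRows k d h 0 s) v).2 ⟨g, hv⟩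
  rw [← rigidAt_chartSeries_iff] at hv'
  have hcomp : (normalPoly (v ∘ Sum.inr)).comp (line (v ∘ Sum.inl)) =
      Polynomial.C (Polynomial.X ^ (2 * 0)) * normalPoly (v ∘ Sum.inr) := by
    rw [line_of_isEmpty, Polynomial.comp_X]
    simp
  have hbd : (normalPoly (v ∘ Sum.inr)).natDegree ≤ d ∧
      polyHeight (normalPoly (v ∘ Sum.inr)) ≤ h := by
    refine ⟨natDegree_normalPoly_le hd _, polyHeight_le_iff_coeff.2 fun i j hi => ?_⟩
    exact coeff_coeff_normalPoly_eq_zero _ (fun p hp => by have := p.1.1.2; omega) (by omega)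
  rw [mem_stratumImage_iff]
  refine ⟨_, hv'.irreducible (aeval_chartSeries hcomp) hbd.1 hbd.2 ?_, hbd.1, hbd.2, hcomp⟩
  change ((normalPoly (v ∘ Sum.inr)).coeff 1).coeff 0 ≠ 0
  rw [normalPoly_coeff_one_coeff_zero]
  exact one_ne_zero

theorem le_zariskiDim_imageUnion [Infinite k] (hd : 1 ≤ d) (hh : 1 ≤ h) {M : ℕ}
    (ι : (e : ℕ) → (ChartIndex d h e → k) →ᵃ[k] (Fin M → k))
    (hι : Function.Injective (ι 0)) :
    ((d * h + d + h - 1 : ℕ) : WithBot ℕ∞) ≤ zariskiDim (imageUnion d h ι) := by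
  classical
  obtain ⟨g, hg0, hg⟩ := exists_open_subset_stratumImage_zero (k := k) hd hh
  obtain ⟨ρ, hρ⟩ := exists_affine_leftInverse hι
  let F : MvPolynomial (Fin M) k →ₐ[k] MvPolynomial (ChartIndex d h 0) k :=
    MvPolynomial.aeval (affinePoly (ι 0))
  have hF : ∀ G ∈ MvPolynomial.vanishingIdeal k (imageUnion d h ι), F G = 0 := by
    intro G hG
    refine (mul_eq_zero.1 (MvPolynomial.funext fun v => ?_ : F G * g = 0)).resolve_right hg0
    rw [map_mul, map_zero, aeval_affinePoly_eval]
    by_cases hv : MvPolynomial.eval v g = 0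
    · rw [hv, mul_zero]
    · have h1 := MvPolynomial.mem_vanishingIdeal_iff.1 hG (ι 0 v)
        (Set.mem_biUnion (Set.mem_Iic.2 (Nat.zero_le _)) (Set.mem_image_of_mem _ (hg v hv)))
      rw [MvPolynomial.aeval_eq_eval] at h1
      rw [h1, zero_mul]
  have hsurj : Function.Surjective
      (Ideal.Quotient.lift (MvPolynomial.vanishingIdeal k (imageUnion d h ι))
        (F : MvPolynomial (Fin M) k →+* MvPolynomial (ChartIndex d h 0) k) hF) := by
    intro G
    refine ⟨Ideal.Quotient.mk _ (MvPolynomial.aeval (affinePoly ρ) G), ?_⟩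
    change F (MvPolynomial.aeval (affinePoly ρ) G) = G
    apply MvPolynomial.funext
    intro v
    rw [aeval_affinePoly_eval, aeval_affinePoly_eval, hρ]
  refine le_trans (le_of_eq ?_) (ringKrullDim_le_of_surjective _ hsurj)
  rw [MvPolynomial.ringKrullDim_of_isNoetherianRing, ringKrullDim_eq_zero_of_field, zero_add,
    Nat.card_eq_fintype_card, Fintype.card_sum, Fintype.card_fin, zero_add,
    card_coeffIndex _ _ hd]
  simp

end UnionDimension

/-! ### Disjoint affine embeddings of the charts -/

section Embedding

variable {k : Type*} [Field k] {d h : ℕ}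

theorem exists_affine_embedding {σ : Type*} {N : ℕ} {n₀ : Option (Fin N)}
    (j : σ ↪ {n : Fin N // some n ≠ n₀}) (t : k) :
    ∃ φ : (σ → k) →ᵃ[k] (Fin N → k), Function.Injective φ ∧
      ∀ n, some n = n₀ → ∀ v, φ v n = t := by
  classical
  let i : σ → Fin N := fun s => (j s).1
  have hi : Function.Injective i := Subtype.val_injective.comp j.injective
  let w : Fin N → k := fun n => if some n = n₀ then t else 0
  let φ : (σ → k) →ᵃ[k] (Fin N → k) :=
    (Function.ExtendByZero.linearMap k i).toAffineMap + AffineMap.const k _ w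
  have hφ : ∀ v n, φ v n = Function.extend i v 0 n + w n := fun v n => rfl
  refine ⟨φ, fun v v' hv => ?_, fun n hn v => ?_⟩
  · funext s
    have h1 := congrFun hv (i s)
    rwa [hφ, hφ, hi.extend_apply, hi.extend_apply, add_left_inj] at h1
  · rw [hφ, Function.extend_apply', Pi.zero_apply, zero_add]
    · exact if_pos hn
    · rintro ⟨s, rfl⟩
      exact (j s).2 hn

theorem card_chartIndex_add (hd : 1 ≤ d) {e : ℕ} (he : e ≤ 2 * d * h) :
    Fintype.card (ChartIndex d h e) + (2 * d * h - e) * (1 + (d + 1) * (d - 2)) =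
      ambientDim d h := by
  rw [Fintype.card_sum, Fintype.card_fin, card_coeffIndex _ _ hd, ambientDim]
  obtain ⟨r, hr⟩ := Nat.exists_eq_add_of_le he
  generalize d - 2 = m
  rw [hr, Nat.add_sub_cancel_left]
  have h3 : 3 * d * h = e + r + d * h := by rw [← hr]; ring
  rw [h3]
  have h1 : d * (h + e * m) + d + (h + e * m) - 1 = d * (h + e * m) + (d - 1) + (h + e * m) := by
    omega
  have h2 : (e + r) * m * (d + 1) + (e + r + d * h) + d + h - 1 =
      (e + r) * m * (d + 1) + (e + r + d * h) + (d - 1) + h := by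
    omega
  rw [h1, h2]
  ring

/-- Below `e = 2dh` the charts are smaller than the ambient space, so that their images can be put
into distinct parallel hyperplanes `c = t e`. -/
theorem exists_affine_embeddings [Infinite k] (hd : 1 ≤ d) :
    ∃ (ι : (e : ℕ) → (ChartIndex d h e → k) →ᵃ[k] (Fin (ambientDim d h) → k))
      (c : (Fin (ambientDim d h) → k) → k) (t : ℕ → k), Function.Injective t ∧
      (∀ e ≤ 2 * d * h, Function.Injective (ι e)) ∧
      ∀ e < 2 * d * h, ∀ v, c (ι e v) = t e := by
  classical
  let t : ℕ ↪ k := Infinite.natEmbedding k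
  let c : (Fin (ambientDim d h) → k) → k := fun w =>
    if hN : 0 < ambientDim d h then w ⟨ambientDim d h - 1, by omega⟩ else 0
  have key : ∀ e : ℕ, ∃ φ : (ChartIndex d h e → k) →ᵃ[k] (Fin (ambientDim d h) → k),
      (e ≤ 2 * d * h → Function.Injective φ) ∧ (e < 2 * d * h → ∀ v, c (φ v) = t e) := by
    intro e
    by_cases he : e < 2 * d * h
    · have hcard := card_chartIndex_add hd he.le
      have hpos : 0 < (2 * d * h - e) * (1 + (d + 1) * (d - 2)) :=
        Nat.mul_pos (by omega) (by omega)
      have hN : 0 < ambientDim d h := by omega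
      let n₀ : Fin (ambientDim d h) := ⟨ambientDim d h - 1, by omega⟩
      have hle : Fintype.card (ChartIndex d h e) ≤
          Fintype.card {n : Fin (ambientDim d h) // some n ≠ some n₀} := by
        have h1 : Fintype.card {n : Fin (ambientDim d h) // some n ≠ some n₀} =
            ambientDim d h - 1 := by
          simp only [ne_eq, Option.some.injEq]
          rw [Fintype.card_subtype_compl, Fintype.card_fin, Fintype.card_subtype_eq]
        omega
      obtain ⟨j⟩ := Function.Embedding.nonempty_of_card_le hle
      obtain ⟨φ, hφ, hφ'⟩ := exists_affine_embedding j (t e)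
      refine ⟨φ, fun _ => hφ, fun _ v => ?_⟩
      have : c (φ v) = φ v n₀ := dif_pos hN
      rw [this]
      exact hφ' n₀ rfl v
    · by_cases he' : e ≤ 2 * d * h
      · have hcard := card_chartIndex_add hd he'
        have hle : Fintype.card (ChartIndex d h e) ≤
            Fintype.card {n : Fin (ambientDim d h) // some n ≠ none} := by
          have h1 : Fintype.card {n : Fin (ambientDim d h) // some n ≠ none} =
              ambientDim d h := by
            simp
          omega
        obtain ⟨j⟩ := Function.Embedding.nonempty_of_card_le hle
        obtain ⟨φ, hφ, -⟩ := exists_affine_embedding j (0 : k)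
        exact ⟨φ, fun _ => hφ, fun h => absurd h he⟩
      · exact ⟨0, fun h => absurd h he', fun h => absurd h he⟩
  choose ι hι hι' using key
  exact ⟨ι, c, t, t.injective, hι, hι'⟩

theorem eq_of_mem_stratum {f : k⟦X⟧} {e e' : ℕ} (hf : f ∈ stratum k d h e)
    (hf' : f ∈ stratum k d h e') : e = e' := by
  have : (e : ℕ∞) = e' := hf.2.symm.trans hf'.2
  exact Nat.cast_inj.1 this

/-- The strata glue to a bijection onto the union of their images. -/
theorem exists_bijOn_imageUnion [IsAlgClosed k] (hd : 1 ≤ d) :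
    ∃ (ι : (e : ℕ) → (ChartIndex d h e → k) →ᵃ[k] (Fin (ambientDim d h) → k))
      (Ψ : k⟦X⟧ → (Fin (ambientDim d h) → k)),
      (∀ e ≤ 2 * d * h, Function.Injective (ι e)) ∧
      (∀ e ≤ 2 * d * h, ∀ f ∈ stratum k d h e, Ψ f = ι e (chart d h e f)) ∧
      Set.BijOn Ψ (algSetZero k d h) (imageUnion d h ι) := by
  classical
  have : Infinite k := IsAlgClosed.instInfinite
  obtain ⟨ι, c, t, ht, hι, hc⟩ := exists_affine_embeddings (k := k) (h := h) hd
  let Ψ : k⟦X⟧ → (Fin (ambientDim d h) → k) := fun f =>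
    if H : ∃ e, f ∈ stratum k d h e then ι H.choose (chart d h H.choose f) else 0
  have hΨ : ∀ e, ∀ f ∈ stratum k d h e, Ψ f = ι e (chart d h e f) := by
    intro e f hf
    have H : ∃ e, f ∈ stratum k d h e := ⟨e, hf⟩
    have h1 : H.choose = e := eq_of_mem_stratum H.choose_spec hf
    have h2 : Ψ f = ι H.choose (chart d h H.choose f) := dif_pos H
    rw [h2, h1]
  refine ⟨ι, Ψ, hι, fun e _ => hΨ e, ?_, ?_, ?_⟩
  · intro f hf
    obtain ⟨e, he, hfe⟩ : ∃ e ≤ 2 * d * h, f ∈ stratum k d h e := by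
      rw [algSetZero_eq_iUnion] at hf
      simpa using hf
    rw [hΨ e f hfe]
    exact Set.mem_biUnion (Set.mem_Iic.2 he)
      (Set.mem_image_of_mem _ (Set.mem_image_of_mem _ hfe))
  · intro f hf g hg hfg
    obtain ⟨e, he, hfe⟩ := exists_mem_stratum hf
    obtain ⟨e', he', hge⟩ := exists_mem_stratum hg
    rw [hΨ e f hfe, hΨ e' g hge] at hfg
    have hee : e = e' := by
      by_contra hne
      have hpos : 0 < h := by
        rcases Nat.eq_zero_or_pos h with rfl | hpos
        · simp only [mul_zero] at he he'
          omega
        · exact hpos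
      -- nonempty strata have `e ≤ (2d - 1) h < 2dh`
      have hlt : (2 * d - 1) * h < 2 * d * h := Nat.mul_lt_mul_of_pos_right (by omega) hpos
      have h1 := congrArg c hfg
      rw [hc e (he.trans_lt hlt), hc e' (he'.trans_lt hlt)] at h1
      exact hne (ht h1)
    subst hee
    have hle : (2 * d - 1) * h ≤ 2 * d * h := Nat.mul_le_mul_right _ (Nat.sub_le _ _)
    exact injOn_chart hfe hge (hι e (he.trans hle) hfg)
  · intro w hw
    simp only [imageUnion, Set.mem_iUnion] at hw
    obtain ⟨e, he, _, ⟨f, hf, rfl⟩, rfl⟩ := hw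
    exact ⟨f, hf.1, hΨ e f hf⟩

theorem isConstructibleSet_imageUnion {M : ℕ}
    (ι : (e : ℕ) → (ChartIndex d h e → k) →ᵃ[k] (Fin M → k))
    (hι : ∀ e ≤ 2 * d * h, Function.Injective (ι e)) :
    IsConstructibleSet (imageUnion d h ι) :=
  isConstructibleSet_biUnion (Set.finite_Iic _) fun e he =>
    (isConstructibleSet_stratumImage d h e).image_affine (hι e he)

end Embedding

end AlgSeries

end

theorem theorem2 {k : Type*} [Field k] [IsAlgClosed k] (d h : ℕ) :
    -- (i) the maps on the strata, and their images
    (∀ e : ℕ,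
      Set.MapsTo (AlgSeries.tail e) (AlgSeries.stratum k d h e)
        (AlgSeries.implicitSet k d (h + e * (d - 2))) ∧
      Set.InjOn (AlgSeries.chart d h e) (AlgSeries.stratum k d h e) ∧
      AlgSeries.stratumImage k d h e ⊆
        {v | v ∘ Sum.inr ∈ AlgSeries.implicitImage k d (h + e * (d - 2))} ∧
      AlgSeries.IsConstructibleSet (AlgSeries.stratumImage k d h e)) ∧
    (1 ≤ d →
      -- (ii) the finite stratification and the identification with a union in one affine space
      (AlgSeries.algSetZero k d h =
        ⋃ e ∈ Set.Iic (2 * d * h), AlgSeries.stratum k d h e) ∧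
      (∃ (ι : (e : ℕ) →
            (AlgSeries.ChartIndex d h e → k) →ᵃ[k] (Fin (AlgSeries.ambientDim d h) → k))
          (Ψ : PowerSeries k → (Fin (AlgSeries.ambientDim d h) → k)),
        (∀ e ≤ 2 * d * h, Function.Injective (ι e)) ∧
        (∀ e ≤ 2 * d * h, ∀ f ∈ AlgSeries.stratum k d h e,
          Ψ f = ι e (AlgSeries.chart d h e f)) ∧
        Set.BijOn Ψ (AlgSeries.algSetZero k d h) (AlgSeries.imageUnion d h ι)) ∧
      -- (ii), (iii) constructibility and dimension, for every choice of the affine embeddings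
      ∀ (M : ℕ) (ι : (e : ℕ) → (AlgSeries.ChartIndex d h e → k) →ᵃ[k] (Fin M → k)),
        (∀ e ≤ 2 * d * h, Function.Injective (ι e)) →
        AlgSeries.IsConstructibleSet (AlgSeries.imageUnion d h ι) ∧
        (1 ≤ h →
          AlgSeries.zariskiDim (AlgSeries.imageUnion d h ι) =
            ((d * h + d + h - 1 : ℕ) : WithBot ℕ∞))) := by
  refine ⟨fun e => ⟨AlgSeries.mapsTo_tail, AlgSeries.injOn_chart, AlgSeries.stratumImage_subset,
    AlgSeries.isConstructibleSet_stratumImage d h e⟩, fun hd =>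
    ⟨AlgSeries.algSetZero_eq_iUnion, AlgSeries.exists_bijOn_imageUnion hd, fun M ι hι =>
    ⟨AlgSeries.isConstructibleSet_imageUnion ι hι, fun hh => ?_⟩⟩⟩
  have : Infinite k := IsAlgClosed.instInfinite
  exact le_antisymm (AlgSeries.zariskiDim_imageUnion_le hd ι hι)
    (AlgSeries.le_zariskiDim_imageUnion hd hh ι (hι 0 (Nat.zero_le _)))
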